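/- Notation. Let $\mathbb{D}\subset\mathbb{C}$ be the open unit disc, $\mathbb{T}$ the unit circle, and let $H$ be a complex Hilbert space. A commuting pair $(T_1,T_2)$ in $B(H)$ has Taylor spectrum $\sigma(T_1,T_2)$. A compact set $X\subset\mathbb{C}^2$ is a *spectral set* for $(T_1,T_2)$ if $\sigma(T_1,T_2)\subset X$ and, for every rational function $r=p/q$ with $p,q\in\mathbb{C}[z,w]$ and $q$ zero-free on $X$, the operator $q(T_1,T_2)$ is invertible and $r(T_1,T_2)=p(T_1,T_2)\,q(T_1,T_2)^{-1}$ (the Taylor functional calculus of $r$) satisfies $\|r(T_1,T_2)\|\le\sup_X|r|$. A compact set $K\subset\mathbb{C}^2$ is *polynomially convex* if every $x\in\mathbb{C}^2$ with $|p(x)|\le\max_K|p|$ for all polynomials $p$ belongs to $K$. An *Agler--McCarthy distinguished variety* for $(T_1,T_2)$ is a non-empty set of the form $$V=\{(z,w)\in\mathbb{D}^2:\det(\Psi(z)-wI)=0\},$$ where $\Psi:\mathbb{D}\to B(E)$ is holomorphic and contractive ($\|\Psi(z)\|\le1$ for all $z\in\mathbb{D}$) and $E$ is a finite-dimensional complex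 Hilbert space, such that $\overline V\setminus\mathbb{D}^2\subset\mathbb{T}^2$ and $$\|p(T_1,T_2)\|\le\sup_V|p|\quad\text{for every polynomial }p\in\mathbb{C}[z,w].$$ Theorem. Let $T_1,T_2\in B(H)$ be commuting contractions and let $V\subset\mathbb{D}^2$ be an Agler--McCarthy distinguished variety for $(T_1,T_2)$. Then: 1. $\overline V$ is a spectral set for $(T_1,T_2)$; 2. there is a polynomial $\psi\in\mathbb{C}[z,w]$ such that $\overline V=\{(z,w)\in\overline{\mathbb{D}}^2:\psi(z,w)=0\}$; 3. $\overline V$ is polynomially convex. -/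

import Mathlib

open Set Metric

noncomputable section

namespace Bidisc

/-- The open unit bidisc `𝔻²` in `ℂ²`. -/
def openBidisc : Set (ℂ × ℂ) := ball 0 1 ×ˢ ball 0 1

/-- The closed unit bidisc. -/
def closedBidisc : Set (ℂ × ℂ) := closedBall 0 1 ×ˢ closedBall 0 1

/-- The distinguished boundary `𝕋²` of the bidisc. -/
def torus : Set (ℂ × ℂ) := sphere 0 1 ×ˢ sphere 0 1

/-- The value `p(z, w)` of a polynomial in two variables. -/
def polyEval (p : MvPolynomial (Fin 2) ℂ) (x : ℂ × ℂ) : ℂ :=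
  MvPolynomial.eval ![x.1, x.2] p

/-- The sup norm of a function over a set. -/
def supNorm (X : Set (ℂ × ℂ)) (f : ℂ × ℂ → ℂ) : ℝ := ⨆ x : X, ‖f x‖

/-- A compact set `K ⊆ ℂ²` is polynomially convex when it contains every point `x` such that
`|p(x)| ≤ max_K |p|` for all polynomials `p`. -/
def IsPolynomiallyConvex (K : Set (ℂ × ℂ)) : Prop :=
  IsCompact K ∧ ∀ x : ℂ × ℂ,
    (∀ p : MvPolynomial (Fin 2) ℂ, ‖polyEval p x‖ ≤ supNorm K (polyEval p)) → x ∈ K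

section Operators

variable {H : Type*} [NormedAddCommGroup H] [InnerProductSpace ℂ H]

/-- The operator `p(T₁, T₂)`, for commuting `T₁, T₂`. -/
def polyOp (T₁ T₂ : H →L[ℂ] H) (p : MvPolynomial (Fin 2) ℂ) : H →L[ℂ] H :=
  ∑ m ∈ p.support, p.coeff m • (T₁ ^ m 0 * T₂ ^ m 1)

/-- The operator `(p / q)(T₁, T₂) = p(T₁, T₂) q(T₁, T₂)⁻¹`, used only when `q(T₁, T₂)` is
invertible. -/
def ratOp (T₁ T₂ : H →L[ℂ] H) (p q : MvPolynomial (Fin 2) ℂ) : H →L[ℂ] H :=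
  polyOp T₁ T₂ p * Ring.inverse (polyOp T₁ T₂ q)

/-- A unital homomorphism sending the coordinates to `T₁, T₂` is `p ↦ p(T₁, T₂)` on polynomials. -/
theorem polyOp_eq_of_algHom {A : Type*} [CommRing A] [Algebra ℂ A] (T₁ T₂ : H →L[ℂ] H)
    (Φ : A →ₐ[ℂ] (H →L[ℂ] H)) (z w : A) (hz : Φ z = T₁) (hw : Φ w = T₂)
    (p : MvPolynomial (Fin 2) ℂ) :
    Φ (MvPolynomial.aeval ![z, w] p) = polyOp T₁ T₂ p := by
  rw [MvPolynomial.aeval_def, MvPolynomial.eval₂_eq', map_sum]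
  simp [polyOp, Fin.prod_univ_two, hz, hw, Algebra.smul_def]

/-- Every unital homomorphism `Φ : A → B(H)` that sends the coordinates to `T₁, T₂`, for instance
the Taylor functional calculus on the algebra `A` of functions holomorphic near a compact set `X`,
makes `q(T₁, T₂)` invertible when `q` is invertible in `A`, and sends `p / q` to `ratOp T₁ T₂ p q`.
Hence `ratOp` is the Taylor functional calculus on rational functions. -/
theorem ratOp_eq_of_algHom {A : Type*} [CommRing A] [Algebra ℂ A] (T₁ T₂ : H →L[ℂ] H)
    (Φ : A →ₐ[ℂ] (H →L[ℂ] H)) (z w : A) (hz : Φ z = T₁) (hw : Φ w = T₂)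
    (p q : MvPolynomial (Fin 2) ℂ) (s : A) (hs : MvPolynomial.aeval ![z, w] q * s = 1) :
    IsUnit (polyOp T₁ T₂ q) ∧
      Φ (MvPolynomial.aeval ![z, w] p * s) = ratOp T₁ T₂ p q := by
  have h1 : polyOp T₁ T₂ q * Φ s = 1 := by
    rw [← polyOp_eq_of_algHom T₁ T₂ Φ z w hz hw, ← map_mul, hs, map_one]
  have h2 : Φ s * polyOp T₁ T₂ q = 1 := by
    rw [← polyOp_eq_of_algHom T₁ T₂ Φ z w hz hw, ← map_mul, mul_comm, hs, map_one]
  have hinv : Ring.inverse (polyOp T₁ T₂ q) = Φ s :=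
    Ring.inverse_unit (⟨polyOp T₁ T₂ q, Φ s, h1, h2⟩ : (H →L[ℂ] H)ˣ)
  refine ⟨⟨⟨_, _, h1, h2⟩, rfl⟩, ?_⟩
  rw [ratOp, hinv, map_mul, polyOp_eq_of_algHom T₁ T₂ Φ z w hz hw]

/-- First differential `H → H ⊕ H` of the Koszul complex of a commuting pair. -/
def koszulFst (A₁ A₂ : H →L[ℂ] H) : H →L[ℂ] H × H := (-A₂).prod A₁

/-- Second differential `H ⊕ H → H` of the Koszul complex of a commuting pair. -/
def koszulSnd (A₁ A₂ : H →L[ℂ] H) : H × H →L[ℂ] H := A₁.coprod A₂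

/-- Exactness of the Koszul complex `0 → H → H ⊕ H → H → 0`. -/
def KoszulExact (A₁ A₂ : H →L[ℂ] H) : Prop :=
  Function.Injective (koszulFst A₁ A₂) ∧
    Function.Exact (koszulFst A₁ A₂) (koszulSnd A₁ A₂) ∧
      Function.Surjective (koszulSnd A₁ A₂)

/-- The Taylor spectrum of a commuting pair. -/
def taylorSpectrum (T₁ T₂ : H →L[ℂ] H) : Set (ℂ × ℂ) :=
  {x | ¬ KoszulExact (T₁ - x.1 • ContinuousLinearMap.id ℂ H)
    (T₂ - x.2 • ContinuousLinearMap.id ℂ H)}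

/-- `X` is a spectral set for the commuting pair `(T₁, T₂)`: it is compact, it contains the Taylor
spectrum, and the functional calculus is defined and contractive on the rational functions with
poles outside of `X`, with respect to the sup norm over `X`. -/
structure IsSpectralSet (T₁ T₂ : H →L[ℂ] H) (X : Set (ℂ × ℂ)) : Prop where
  isCompact : IsCompact X
  taylorSpectrum_subset : taylorSpectrum T₁ T₂ ⊆ X
  isUnit : ∀ q : MvPolynomial (Fin 2) ℂ, (∀ x ∈ X, polyEval q x ≠ 0) → IsUnit (polyOp T₁ T₂ q)
  norm_le : ∀ p q : MvPolynomial (Fin 2) ℂ, (∀ x ∈ X, polyEval q x ≠ 0) →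
    ‖ratOp T₁ T₂ p q‖ ≤ supNorm X (fun x => polyEval p x / polyEval q x)

end Operators

section Varieties

variable {E : Type*} [NormedAddCommGroup E] [InnerProductSpace ℂ E]

/-- `V_Ψ = {(z, w) ∈ 𝔻² : det (Ψ(z) - w I) = 0}`. -/
def detVariety (Ψ : ℂ → E →L[ℂ] E) : Set (ℂ × ℂ) :=
  {x | x ∈ openBidisc ∧ (Ψ x.1 - x.2 • ContinuousLinearMap.id ℂ E).det = 0}

/-- `Ψ` is a contractive holomorphic function on the open unit disc (only its values there
matter). -/
def IsContractiveHolomorphic (Ψ : ℂ → E →L[ℂ] E) : Prop :=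
  DifferentiableOn ℂ Ψ (ball 0 1) ∧ ∀ z ∈ ball (0 : ℂ) 1, ‖Ψ z‖ ≤ 1

/-- `V ⊆ 𝔻²` is distinguished: it is non-empty and its closure leaves the bidisc only through the
distinguished boundary. -/
def IsDistinguished (V : Set (ℂ × ℂ)) : Prop :=
  V ⊆ openBidisc ∧ V.Nonempty ∧ closure V \ openBidisc ⊆ torus

/-- `V` is an Agler–McCarthy distinguished variety for the pair `(T₁, T₂)`, realized by the
contractive holomorphic operator-valued function `Ψ`. -/
structure IsAglerMcCarthyDistinguished {H : Type*} [NormedAddCommGroup H] [InnerProductSpace ℂ H]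
    (T₁ T₂ : H →L[ℂ] H) (Ψ : ℂ → E →L[ℂ] E) (V : Set (ℂ × ℂ)) : Prop where
  contractive : IsContractiveHolomorphic Ψ
  eq_detVariety : V = detVariety Ψ
  distinguished : IsDistinguished V
  norm_le : ∀ p : MvPolynomial (Fin 2) ℂ, ‖polyOp T₁ T₂ p‖ ≤ supNorm V (polyEval p)

end Varieties

end Bidisc

end

/-! Everything rests on showing that the closure of `V` is algebraic. A unimodular eigenvalue of a
contractive holomorphic `Ψ` is constant in `z`, with constant eigenvector, by the maximum principle,
and its eigenvector spans a reducing subspace. Splitting these off leaves monic polynomials `P z` in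
`w`, of fixed degree `m` and with coefficients `a_k` holomorphic in `z`, whose roots `W z i` lie in
the open disc and sweep out `V` (`IsContractiveHolomorphic.exists_monic_family`).

Since `V` is distinguished, all `|W z i|` tend to 1 as `|z|` tends to 1. Hence `|a_0|` tends to 1,
and `a_0` is a finite Blaschke product `p / q`. A monic polynomial with unimodular roots satisfies
`a_0 conj(a_k) = a_(m-k)`; here this holds asymptotically at the circle. As `p = c z ^ N conj(q)`
there, `c z ^ N conj(q a_k) - q a_(m-k)` tends to 0, and comparing Fourier coefficients makes `q
a_k` a polynomial (`exists_eval_eq_of_tendsto`). So `ψ(z, w) = q(z) ∏ (w - W z i)` is a polynomial,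
and since `q` has no zero on the closed disc, the zeros of `ψ` in the closed bidisc are exactly the
closure of `V`.

Polynomial convexity follows by testing with `z`, `w` and `ψ`. It yields the spectral set property:
characters of the uniform closure of the polynomials on `K` are evaluations at points of the hull,
that is of `K`, so `1 / q` is a uniform limit of polynomials on `K`, and the von Neumann inequality
passes from polynomials to rational functions. -/

noncomputable section

namespace Bidisc

/-! ### Polynomial calculus and Koszul complex of a commuting pair. -/

section PolynomialCalculus

variable {H : Type*} [NormedAddCommGroup H] [InnerProductSpace ℂ H]

open scoped IsMulCommutative in
/-- The polynomial calculus of a commuting pair is an algebra homomorphism. -/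
theorem exists_algHom_eq_polyOp {T₁ T₂ : H →L[ℂ] H} (hcomm : Commute T₁ T₂) :
    ∃ Φ : MvPolynomial (Fin 2) ℂ →ₐ[ℂ] (H →L[ℂ] H), ∀ p, Φ p = polyOp T₁ T₂ p := by
  have hc : ∀ a ∈ ({T₁, T₂} : Set (H →L[ℂ] H)), ∀ b ∈ ({T₁, T₂} : Set (H →L[ℂ] H)),
      a * b = b * a := by
    rintro a (rfl | rfl) b (rfl | rfl)
    exacts [rfl, hcomm, hcomm.symm, rfl]
  have := Algebra.isMulCommutative_adjoin ℂ hc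
  let z : Algebra.adjoin ℂ {T₁, T₂} := ⟨T₁, Algebra.subset_adjoin (by simp)⟩
  let w : Algebra.adjoin ℂ {T₁, T₂} := ⟨T₂, Algebra.subset_adjoin (by simp)⟩
  exact ⟨(Algebra.adjoin ℂ {T₁, T₂}).val.comp (MvPolynomial.aeval ![z, w]),
    fun p => polyOp_eq_of_algHom T₁ T₂ (Algebra.adjoin ℂ {T₁, T₂}).val z w rfl rfl p⟩

theorem polyOp_X_zero (T₁ T₂ : H →L[ℂ] H) : polyOp T₁ T₂ (MvPolynomial.X 0) = T₁ := by
  simp [polyOp, MvPolynomial.support_X]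

theorem polyOp_X_one (T₁ T₂ : H →L[ℂ] H) : polyOp T₁ T₂ (MvPolynomial.X 1) = T₂ := by
  simp [polyOp, MvPolynomial.support_X]

/-- If `A₁ G₁ + A₂ G₂` is invertible and all these operators commute, then the Koszul complex of
`(A₁, A₂)` is exact. -/
theorem koszulExact_of_mul_add_mul_eq {A₁ A₂ G₁ G₂ : H →L[ℂ] H} (h : Commute A₁ A₂)
    (h11 : Commute A₁ G₁) (h12 : Commute A₁ G₂) (h21 : Commute A₂ G₁) (h22 : Commute A₂ G₂)
    (hG : A₁ * G₁ + A₂ * G₂ = 1) : KoszulExact A₁ A₂ := by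
  have e (B C : H →L[ℂ] H) (hBC : Commute B C) (x : H) : B (C x) = C (B x) :=
    congrArg (fun D : H →L[ℂ] H => D x) hBC
  have hG' (x : H) : A₁ (G₁ x) + A₂ (G₂ x) = x := congrArg (fun D : H →L[ℂ] H => D x) hG
  refine ⟨?_, ?_, ?_⟩
  · rw [injective_iff_map_eq_zero]
    intro x hx
    simp only [koszulFst, ContinuousLinearMap.prod_apply, Prod.mk_eq_zero,
      neg_apply, neg_eq_zero] at hx
    rw [← hG' x, e _ _ h11, e _ _ h22, hx.1, hx.2]
    simp
  · rintro ⟨x, y⟩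
    simp only [koszulSnd, koszulFst, ContinuousLinearMap.coprod_apply, Set.mem_range,
      ContinuousLinearMap.prod_apply, neg_apply, Prod.mk.injEq]
    constructor
    · intro hxy
      -- The contracting homotopy of the Koszul complex given by `G₁, G₂`.
      refine ⟨G₁ y - G₂ x, ?_, ?_⟩
      · have h1 : A₁ (G₁ x) + G₁ (A₂ y) = 0 := by
          rw [e _ _ h11, ← map_add, hxy, map_zero]
        rw [map_sub, e _ _ h21, eq_neg_of_add_eq_zero_right h1]
        simpa [add_comm] using hG' x
      · have h1 : G₂ (A₁ x) + A₂ (G₂ y) = 0 := by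
          rw [e _ _ h22, ← map_add, hxy, map_zero]
        rw [map_sub, e _ _ h12, eq_neg_of_add_eq_zero_left h1]
        simpa using hG' y
    · rintro ⟨u, rfl, rfl⟩
      rw [map_neg, e _ _ h]
      simp
  · intro x
    exact ⟨(G₁ x, G₂ x), hG' x⟩

end PolynomialCalculus

/-! ### Gelfand theory of the uniform closure of the polynomials on a compact set. -/

section UniformAlgebra

variable {K : Set (ℂ × ℂ)}

/-- Restriction of polynomials to a subset of `ℂ²`. -/
def restrictPoly (K : Set (ℂ × ℂ)) : MvPolynomial (Fin 2) ℂ →ₐ[ℂ] C(K, ℂ) :=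
  MvPolynomial.aeval ![⟨fun x => x.1.1, by fun_prop⟩, ⟨fun x => x.1.2, by fun_prop⟩]

theorem restrictPoly_apply (p : MvPolynomial (Fin 2) ℂ) (x : K) :
    restrictPoly K p x = polyEval p x := by
  have : (Pi.evalAlgHom ℂ (fun _ : K => ℂ) x).comp
      ((ContinuousMap.coeFnAlgHom ℂ).comp (restrictPoly K)) =
      MvPolynomial.aeval ![x.1.1, x.1.2] := by
    ext i
    fin_cases i <;> simp [restrictPoly]
  have := DFunLike.congr_fun this p
  simpa [polyEval, MvPolynomial.aeval_eq_eval] using this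

theorem continuous_polyEval (p : MvPolynomial (Fin 2) ℂ) : Continuous (polyEval p) := by
  refine (MvPolynomial.continuous_eval p).comp (continuous_pi fun i => ?_)
  fin_cases i
  · exact continuous_fst
  · exact continuous_snd

theorem norm_restrictPoly [CompactSpace K] (p : MvPolynomial (Fin 2) ℂ) :
    ‖restrictPoly K p‖ = supNorm K (polyEval p) := by
  rw [ContinuousMap.norm_eq_iSup_norm]
  simp only [restrictPoly_apply, supNorm]

/-- Every character of the polynomial algebra is the evaluation at a point. -/
theorem exists_algHom_eq_polyEval (χ : MvPolynomial (Fin 2) ℂ →ₐ[ℂ] ℂ) :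
    ∃ x : ℂ × ℂ, ∀ p, χ p = polyEval p x := by
  refine ⟨(χ (MvPolynomial.X 0), χ (MvPolynomial.X 1)), fun p => ?_⟩
  have : χ = MvPolynomial.aeval ![χ (MvPolynomial.X 0), χ (MvPolynomial.X 1)] := by
    ext i
    fin_cases i <;> simp
  rw [this, MvPolynomial.aeval_eq_eval]
  simp [polyEval]

/-- Gelfand theory for an algebra with two distinguished elements: a polynomial in them that is not
invertible vanishes at the point given by some character. -/
theorem exists_polyEval_eq_zero_of_not_isUnit {A : Type*} [NormedCommRing A] [NormedAlgebra ℂ A]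
    [CompleteSpace A] [NormOneClass A] (ι : MvPolynomial (Fin 2) ℂ →ₐ[ℂ] A)
    {q : MvPolynomial (Fin 2) ℂ} (hq : ¬ IsUnit (ι q)) :
    ∃ x : ℂ × ℂ, polyEval q x = 0 ∧ ∀ p, ‖polyEval p x‖ ≤ ‖ι p‖ := by
  obtain ⟨φ, hφ⟩ := WeakDual.CharacterSpace.exists_apply_eq_zero hq
  obtain ⟨x, hx⟩ := exists_algHom_eq_polyEval ((WeakDual.CharacterSpace.toAlgHom φ).comp ι)
  refine ⟨x, (hx q).symm.trans hφ, fun p => ?_⟩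
  rw [← hx]
  exact AlgHom.norm_apply_le_self (WeakDual.CharacterSpace.toAlgHom φ) (ι p)

/-- On a polynomially convex compact set, a zero-free polynomial is invertible in the closure of
the polynomials. -/
theorem exists_polyEval_sub_inv_le (hK : IsPolynomiallyConvex K) (q : MvPolynomial (Fin 2) ℂ)
    (hq : ∀ x ∈ K, polyEval q x ≠ 0) {ε : ℝ} (hε : 0 < ε) :
    ∃ r : MvPolynomial (Fin 2) ℂ, ∀ x ∈ K, ‖polyEval r x - (polyEval q x)⁻¹‖ ≤ ε := by
  -- The Gelfand argument needs `‖1‖ = 1`, which fails on the empty set.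
  rcases K.eq_empty_or_nonempty with rfl | hne
  · exact ⟨0, by simp⟩
  have : CompactSpace K := isCompact_iff_compactSpace.mp hK.1
  have : Nonempty K := hne.to_subtype
  let A := (restrictPoly K).range.topologicalClosure
  have : CompleteSpace A :=
    (Subalgebra.isClosed_topologicalClosure (restrictPoly K).range).completeSpace_coe
  have : NormOneClass A := ⟨show ‖(1 : C(K, ℂ))‖ = 1 from norm_one⟩
  have hmem (p) : restrictPoly K p ∈ A :=
    Subalgebra.le_topologicalClosure _ ⟨p, rfl⟩
  let ι : MvPolynomial (Fin 2) ℂ →ₐ[ℂ] A := (restrictPoly K).codRestrict A hmem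
  have hunit : IsUnit (ι q) := by
    -- A character killing `q` is evaluation at a point of the polynomial hull of `K`, hence at a
    -- zero of `q` in `K`.
    by_contra hnot
    obtain ⟨x, hx, hle⟩ := exists_polyEval_eq_zero_of_not_isUnit ι hnot
    refine hq x (hK.2 x fun p => ?_) hx
    rw [← norm_restrictPoly]
    exact hle p
  obtain ⟨s, hs⟩ := hunit.exists_right_inv
  obtain ⟨_, ⟨r, rfl⟩, hr⟩ := Metric.mem_closure_iff.1 s.2 ε hε
  refine ⟨r, fun x hx => ?_⟩
  have h1 : polyEval q x * s.1 ⟨x, hx⟩ = 1 := by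
    have := congrArg (fun a : A => a.1 ⟨x, hx⟩) hs
    simpa [ι, restrictPoly_apply] using this
  rw [← eq_inv_of_mul_eq_one_right h1, ← restrictPoly_apply r ⟨x, hx⟩, ← dist_eq_norm, dist_comm]
  exact (ContinuousMap.dist_apply_le_dist _).trans hr.le

end UniformAlgebra

/-! ### From polynomial convexity to spectral sets. -/

section SpectralSet

variable {H : Type*} [NormedAddCommGroup H] [InnerProductSpace ℂ H] {T₁ T₂ : H →L[ℂ] H}
  {K : Set (ℂ × ℂ)}

/-- Induction through `p X - p(x) x_i = X (p - p(x)) + p(x) (X - x_i)`, with `X` the `i`-th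
variable. Evaluated at the operators, it supplies the coefficients that make the Koszul complex
exact. -/
theorem exists_sub_C_polyEval_eq (p : MvPolynomial (Fin 2) ℂ) (x : ℂ × ℂ) :
    ∃ g h : MvPolynomial (Fin 2) ℂ, p - MvPolynomial.C (polyEval p x) =
      (MvPolynomial.X 0 - MvPolynomial.C x.1) * g + (MvPolynomial.X 1 - MvPolynomial.C x.2) * h := by
  induction p using MvPolynomial.induction_on with
  | C a => exact ⟨0, 0, by simp [polyEval]⟩
  | add p q hp hq =>
    obtain ⟨g, h, hp⟩ := hp
    obtain ⟨g', h', hq⟩ := hq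
    refine ⟨g + g', h + h', ?_⟩
    have : polyEval (p + q) x = polyEval p x + polyEval q x := by simp [polyEval]
    rw [this, map_add]
    linear_combination hp + hq
  | mul_X p i hp =>
    obtain ⟨g, h, hp⟩ := hp
    fin_cases i
    · refine ⟨g * MvPolynomial.X 0 + MvPolynomial.C (polyEval p x), h * MvPolynomial.X 0, ?_⟩
      have : polyEval (p * MvPolynomial.X 0) x = polyEval p x * x.1 := by simp [polyEval]
      simp only [Fin.zero_eta, this, map_mul]
      linear_combination MvPolynomial.X 0 * hp
    · refine ⟨g * MvPolynomial.X 1, h * MvPolynomial.X 1 + MvPolynomial.C (polyEval p x), ?_⟩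
      have : polyEval (p * MvPolynomial.X 1) x = polyEval p x * x.2 := by simp [polyEval]
      simp only [Fin.mk_one, this, map_mul]
      linear_combination MvPolynomial.X 1 * hp

/-- Off `K` some `p` has `|p(x)| > sup_K |p| ≥ ‖p(T₁, T₂)‖`, so `p(T₁, T₂) - p(x)` is invertible; it
is also a combination of `T₁ - x.1` and `T₂ - x.2`. -/
theorem taylorSpectrum_subset_of_norm_le [CompleteSpace H] (hcomm : Commute T₁ T₂)
    (hK : IsPolynomiallyConvex K)
    (hT : ∀ p : MvPolynomial (Fin 2) ℂ, ‖polyOp T₁ T₂ p‖ ≤ supNorm K (polyEval p)) :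
    taylorSpectrum T₁ T₂ ⊆ K := by
  intro x hx
  by_contra hxK
  refine hx ?_
  have : ∃ p : MvPolynomial (Fin 2) ℂ, supNorm K (polyEval p) < ‖polyEval p x‖ := by
    by_contra! h
    exact hxK (hK.2 x h)
  obtain ⟨p, hp⟩ := this
  obtain ⟨Φ, hΦ⟩ := exists_algHom_eq_polyOp hcomm
  obtain ⟨g, h, hgh⟩ := exists_sub_C_polyEval_eq p x
  have hC (a : ℂ) : Φ (MvPolynomial.C a) = a • ContinuousLinearMap.id ℂ H := by
    have := Φ.commutes a
    rw [MvPolynomial.algebraMap_eq] at this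
    rw [this, Algebra.algebraMap_eq_smul_one]
    rfl
  have h1 : Φ (MvPolynomial.X 0 - MvPolynomial.C x.1) = T₁ - x.1 • ContinuousLinearMap.id ℂ H := by
    rw [map_sub, hC, hΦ, polyOp_X_zero]
  have h2 : Φ (MvPolynomial.X 1 - MvPolynomial.C x.2) = T₂ - x.2 • ContinuousLinearMap.id ℂ H := by
    rw [map_sub, hC, hΦ, polyOp_X_one]
  have hcm (a b) : Commute (Φ a) (Φ b) := by
    rw [commute_iff_eq, ← map_mul, mul_comm, map_mul]
  set S := Φ (p - MvPolynomial.C (polyEval p x)) with hS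
  have hunit : IsUnit S := by
    have hmem : polyEval p x ∉ spectrum ℂ (Φ p) := fun hmem => by
      have h3 := spectrum.norm_le_norm_mul_of_mem hmem
      -- Only an inequality, so that `H = 0` is allowed.
      have h4 : ‖(1 : H →L[ℂ] H)‖ ≤ 1 := ContinuousLinearMap.norm_id_le
      have h5 := hT p
      rw [hΦ] at h3
      nlinarith [norm_nonneg (polyOp T₁ T₂ p)]
    rw [spectrum.notMem_iff] at hmem
    have := hmem.neg
    rwa [neg_sub, ← AlgHom.commutes Φ, ← map_sub] at this
  have hcu (a) : Commute (Φ a) (Ring.inverse S) := by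
    obtain ⟨u, hu⟩ := hunit
    rw [← hu, Ring.inverse_unit]
    exact Commute.units_inv_right (hu ▸ hcm _ _)
  rw [← h1, ← h2]
  refine koszulExact_of_mul_add_mul_eq (G₁ := Φ g * Ring.inverse S) (G₂ := Φ h * Ring.inverse S)
    (hcm _ _) ((hcm _ _).mul_right (hcu _)) ((hcm _ _).mul_right (hcu _))
    ((hcm _ _).mul_right (hcu _)) ((hcm _ _).mul_right (hcu _)) ?_
  rw [← mul_assoc, ← mul_assoc, ← add_mul, ← map_mul, ← map_mul, ← map_add, ← hgh]
  exact Ring.mul_inverse_cancel _ hunit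

/-- If `r` is close to `1 / q` on `K`, then `1 - q r` has sup norm at most `1 / 2`, so the product
of the commuting operators `q(T₁, T₂)` and `r(T₁, T₂)` is invertible by the Neumann series. -/
theorem isUnit_polyOp_of_norm_le [CompleteSpace H] (hcomm : Commute T₁ T₂)
    (hK : IsPolynomiallyConvex K)
    (hT : ∀ p : MvPolynomial (Fin 2) ℂ, ‖polyOp T₁ T₂ p‖ ≤ supNorm K (polyEval p))
    (q : MvPolynomial (Fin 2) ℂ) (hq : ∀ x ∈ K, polyEval q x ≠ 0) :
    IsUnit (polyOp T₁ T₂ q) := by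
  have : CompactSpace K := isCompact_iff_compactSpace.mp hK.1
  obtain ⟨Φ, hΦ⟩ := exists_algHom_eq_polyOp hcomm
  set M := ‖restrictPoly K q‖ with hM
  have hM0 : 0 ≤ M := norm_nonneg _
  obtain ⟨r, hr⟩ := exists_polyEval_sub_inv_le hK q hq (ε := 1 / (2 * (M + 1))) (by positivity)
  have h1 : ‖1 - Φ (q * r)‖ < 1 := by
    rw [← map_one Φ, ← map_sub, hΦ]
    refine (hT _).trans_lt ?_
    rw [← norm_restrictPoly]
    refine ((ContinuousMap.norm_le _ (C := 1 / 2) (by norm_num)).2 fun x => ?_).trans_lt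
      (by norm_num)
    rw [restrictPoly_apply]
    have h2 : polyEval (1 - q * r) x
        = -(polyEval q x * (polyEval r x - (polyEval q x)⁻¹)) := by
      have := hq x x.2
      rw [mul_sub, mul_inv_cancel₀ this]
      simp [polyEval]
    have h3 : ‖polyEval q x‖ ≤ M := by
      rw [← restrictPoly_apply]
      exact ContinuousMap.norm_coe_le_norm _ x
    rw [h2, norm_neg, norm_mul]
    calc _ ≤ M * (1 / (2 * (M + 1))) := by gcongr; exact hr x x.2
      _ ≤ 1 / 2 := by
        rw [mul_one_div, div_le_div_iff₀ (by positivity) (by positivity)]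
        linarith
  have h4 : IsUnit (Φ q * Φ r) := by
    have := isUnit_one_sub_of_norm_lt_one h1
    rwa [sub_sub_cancel, map_mul] at this
  rw [← hΦ]
  refine (Commute.isUnit_mul_iff ?_).1 h4 |>.1
  rw [commute_iff_eq, ← map_mul, mul_comm, map_mul]

/-- Write `p / q = p r + p (1 - q r) / q` with `r` within `ε` of `1 / q` on `K`. Both polynomials `p
r` and `p (1 - q r)` obey the von Neumann inequality, and the error is linear in `ε`. -/
theorem norm_ratOp_le [CompleteSpace H] (hcomm : Commute T₁ T₂) (hK : IsPolynomiallyConvex K)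
    (hT : ∀ p : MvPolynomial (Fin 2) ℂ, ‖polyOp T₁ T₂ p‖ ≤ supNorm K (polyEval p))
    (p q : MvPolynomial (Fin 2) ℂ) (hq : ∀ x ∈ K, polyEval q x ≠ 0) :
    ‖ratOp T₁ T₂ p q‖ ≤ supNorm K (fun x => polyEval p x / polyEval q x) := by
  have : CompactSpace K := isCompact_iff_compactSpace.mp hK.1
  obtain ⟨Φ, hΦ⟩ := exists_algHom_eq_polyOp hcomm
  have hunit := isUnit_polyOp_of_norm_le hcomm hK hT q hq
  set S := supNorm K (fun x => polyEval p x / polyEval q x) with hS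
  have hS0 : 0 ≤ S := Real.iSup_nonneg fun _ => norm_nonneg _
  have hSx (x : K) : ‖polyEval p x / polyEval q x‖ ≤ S := by
    refine le_ciSup (f := fun x : K => ‖polyEval p x / polyEval q x‖) ?_ x
    refine (isCompact_range ?_).bddAbove
    have hp' : Continuous fun x : K => polyEval p x :=
      (continuous_polyEval p).comp continuous_subtype_val
    have hq' : Continuous fun x : K => polyEval q x :=
      (continuous_polyEval q).comp continuous_subtype_val
    exact (hp'.div hq' fun x => hq x x.2).norm
  set P := ‖restrictPoly K p‖ with hP
  set Q := ‖restrictPoly K q‖ with hQ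
  have hPx (x : K) : ‖polyEval p x‖ ≤ P := by
    rw [← restrictPoly_apply]
    exact ContinuousMap.norm_coe_le_norm _ x
  have hQx (x : K) : ‖polyEval q x‖ ≤ Q := by
    rw [← restrictPoly_apply]
    exact ContinuousMap.norm_coe_le_norm _ x
  have hP0 : 0 ≤ P := norm_nonneg _
  have hQ0 : 0 ≤ Q := norm_nonneg _
  set B := ‖Ring.inverse (polyOp T₁ T₂ q)‖ with hB
  have hB0 : 0 ≤ B := norm_nonneg _
  have key (ε : ℝ) (hε : 0 < ε) : ‖ratOp T₁ T₂ p q‖ ≤ S + ε * (P + P * Q * B) := by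
    obtain ⟨r, hr⟩ := exists_polyEval_sub_inv_le hK q hq hε
    have h1 : ratOp T₁ T₂ p q = polyOp T₁ T₂ (p * r) +
        polyOp T₁ T₂ (p * (1 - q * r)) * Ring.inverse (polyOp T₁ T₂ q) := by
      have : p * (1 - q * r) = p - p * r * q := by ring
      simp only [ratOp]
      rw [this, ← hΦ (p - _), map_sub, map_mul _ (p * r), sub_mul, mul_assoc, hΦ q,
        Ring.mul_inverse_cancel _ hunit, hΦ p, hΦ (p * r)]
      simp
    have h2 : ‖polyOp T₁ T₂ (p * r)‖ ≤ S + P * ε := by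
      refine (hT _).trans ?_
      rw [← norm_restrictPoly]
      refine (ContinuousMap.norm_le _ (by positivity)).2 fun x => ?_
      rw [restrictPoly_apply]
      have : polyEval (p * r) x = polyEval p x / polyEval q x +
          polyEval p x * (polyEval r x - (polyEval q x)⁻¹) := by
        simp only [polyEval, map_mul]
        ring
      rw [this]
      refine (norm_add_le _ _).trans (add_le_add (hSx x) ?_)
      rw [norm_mul]
      gcongr
      · exact hPx x
      · exact hr x x.2
    have h3 : ‖polyOp T₁ T₂ (p * (1 - q * r))‖ ≤ P * (Q * ε) := by
      refine (hT _).trans ?_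
      rw [← norm_restrictPoly]
      refine (ContinuousMap.norm_le _ (by positivity)).2 fun x => ?_
      rw [restrictPoly_apply]
      have : polyEval (p * (1 - q * r)) x =
          -(polyEval p x * (polyEval q x * (polyEval r x - (polyEval q x)⁻¹))) := by
        rw [mul_sub (polyEval q x), mul_inv_cancel₀ (hq x x.2)]
        simp only [polyEval, map_mul, map_sub, map_one]
        ring
      rw [this, norm_neg, norm_mul, norm_mul]
      gcongr
      · exact hPx x
      · exact hQx x
      · exact hr x x.2
    rw [h1]
    calc _ ≤ (S + P * ε) + P * (Q * ε) * B :=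
          (norm_add_le _ _).trans (add_le_add h2 ((norm_mul_le _ _).trans (by gcongr)))
      _ = _ := by ring
  refine le_of_forall_pos_le_add fun δ hδ => ?_
  have hD : 0 < P + P * Q * B + 1 := by positivity
  refine (key (δ / (P + P * Q * B + 1)) (by positivity)).trans ?_
  gcongr
  rw [div_mul_eq_mul_div, div_le_iff₀ hD]
  nlinarith

/-- A polynomially convex compact set on which the von Neumann inequality holds for polynomials is a
spectral set. -/
theorem IsPolynomiallyConvex.isSpectralSet [CompleteSpace H] (hcomm : Commute T₁ T₂)
    (hK : IsPolynomiallyConvex K)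
    (hT : ∀ p : MvPolynomial (Fin 2) ℂ, ‖polyOp T₁ T₂ p‖ ≤ supNorm K (polyEval p)) :
    IsSpectralSet T₁ T₂ K where
  isCompact := hK.1
  taylorSpectrum_subset := taylorSpectrum_subset_of_norm_le hcomm hK hT
  isUnit := isUnit_polyOp_of_norm_le hcomm hK hT
  norm_le := norm_ratOp_le hcomm hK hT

end SpectralSet

open Filter Topology ComplexConjugate

/-! ### Functions on the disc near the unit circle. -/

section BoundaryFilter

/-- The filter of points of the unit disc approaching the unit circle. -/
def boundaryFilter : Filter ℂ := comap norm (𝓝[<] 1)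

theorem eventually_boundaryFilter {P : ℂ → Prop} :
    (∀ᶠ z in boundaryFilter, P z) ↔ ∃ r < 1, ∀ z : ℂ, r < ‖z‖ → ‖z‖ < 1 → P z := by
  rw [boundaryFilter, eventually_comap]
  constructor
  · intro h
    obtain ⟨r, hr, hrP⟩ := mem_nhdsLT_iff_exists_Ioo_subset.1 h
    exact ⟨r, hr, fun z h1 h2 => hrP ⟨h1, h2⟩ z rfl⟩
  · rintro ⟨r, hr, hrP⟩
    filter_upwards [Ioo_mem_nhdsLT hr] with t ht z hz
    exact hrP z (hz ▸ ht.1) (hz ▸ ht.2)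

theorem eventually_boundaryFilter_mem_ball : ∀ᶠ z in boundaryFilter, z ∈ ball (0 : ℂ) 1 :=
  eventually_boundaryFilter.2 ⟨0, one_pos, fun _ _ h => mem_ball_zero_iff.2 h⟩

theorem tendsto_norm_boundaryFilter : Tendsto (fun z : ℂ => ‖z‖) boundaryFilter (𝓝 1) :=
  tendsto_comap.mono_right nhdsWithin_le_nhds

/-- Maximum principle on the disc for a bound that holds near the circle. -/
theorem norm_le_of_eventually_boundaryFilter {f : ℂ → ℂ} (hf : DifferentiableOn ℂ f (ball 0 1))
    {C : ℝ} (hC : ∀ᶠ z in boundaryFilter, ‖f z‖ ≤ C) {z : ℂ} (hz : z ∈ ball (0 : ℂ) 1) :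
    ‖f z‖ ≤ C := by
  obtain ⟨r, hr, hrC⟩ := eventually_boundaryFilter.1 hC
  rw [mem_ball_zero_iff] at hz
  obtain ⟨R, hR, hR1⟩ := exists_between (max_lt hr hz)
  rw [max_lt_iff] at hR
  have hR0 : 0 < R := (norm_nonneg z).trans_lt hR.2
  refine Complex.norm_le_of_forall_mem_frontier_norm_le (isBounded_ball (x := (0 : ℂ)) (r := R))
    (hf.diffContOnCl_ball (closedBall_subset_ball hR1)) (fun u hu => ?_)
    (subset_closure (mem_ball_zero_iff.2 hR.2))
  rw [frontier_ball _ hR0.ne', mem_sphere_zero_iff_norm] at hu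
  exact hrC u (hu ▸ hR.1) (hu ▸ hR1)

theorem norm_le_one_of_tendsto_boundaryFilter {f : ℂ → ℂ} (hf : DifferentiableOn ℂ f (ball 0 1))
    (h : Tendsto (fun z => ‖f z‖) boundaryFilter (𝓝 1)) {z : ℂ} (hz : z ∈ ball (0 : ℂ) 1) :
    ‖f z‖ ≤ 1 := by
  refine le_of_forall_gt_imp_ge_of_dense fun C hC => ?_
  exact norm_le_of_eventually_boundaryFilter hf (h.eventually_le_const hC) hz

/-- Both `f` and `1 / f` are bounded by 1, so `|f| = 1` throughout and the maximum principle
applies. -/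
theorem exists_eq_const_of_tendsto_boundaryFilter {f : ℂ → ℂ}
    (hf : DifferentiableOn ℂ f (ball 0 1)) (h : Tendsto (fun z => ‖f z‖) boundaryFilter (𝓝 1))
    (h0 : ∀ z ∈ ball (0 : ℂ) 1, f z ≠ 0) :
    ∃ c : ℂ, c ≠ 0 ∧ ∀ z ∈ ball (0 : ℂ) 1, f z = c := by
  have h1 (z : ℂ) (hz : z ∈ ball (0 : ℂ) 1) : ‖f z‖ = 1 := by
    refine le_antisymm (norm_le_one_of_tendsto_boundaryFilter hf h hz) ?_
    have h2 : Tendsto (fun z => ‖(f z)⁻¹‖) boundaryFilter (𝓝 1) := by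
      simpa using h.inv₀ one_ne_zero
    have h3 := norm_le_one_of_tendsto_boundaryFilter (hf.inv h0) h2 hz
    rw [Pi.inv_apply, norm_inv] at h3
    exact (inv_le_one₀ (norm_pos_iff.2 (h0 z hz))).1 h3
  have hmem : (0 : ℂ) ∈ ball (0 : ℂ) 1 := mem_ball_self one_pos
  refine ⟨f 0, h0 0 hmem, fun z hz => ?_⟩
  refine Complex.eqOn_of_isPreconnected_of_isMaxOn_norm (convex_ball 0 1).isPreconnected
    isOpen_ball hf hmem (fun u hu => ?_) hz
  simp [h1 u hu, h1 0 hmem]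

/-- A continuous function vanishing on the torus tends to zero along any family of points
approaching the torus. -/
theorem tendsto_zero_of_tendsto_norm_one {α ι F : Type*} [Fintype ι] [NormedAddCommGroup F]
    {l : Filter α} {W : α → ι → ℂ} (hW : ∀ i, Tendsto (fun a => ‖W a i‖) l (𝓝 1)) {G : (ι → ℂ) → F}
    (hG : Continuous G) (h0 : ∀ w : ι → ℂ, (∀ i, ‖w i‖ = 1) → G w = 0) :
    Tendsto (fun a => G (W a)) l (𝓝 0) := by
  rw [Metric.tendsto_nhds]
  intro ε hε
  have hK : IsCompact (Set.pi univ fun _ : ι => sphere (0 : ℂ) 1) :=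
    isCompact_univ_pi fun _ => isCompact_sphere _ _
  have hU : IsOpen {w | dist (G w) 0 < ε} :=
    isOpen_lt (hG.dist continuous_const) continuous_const
  obtain ⟨δ, hδ, hsub⟩ := hK.exists_thickening_subset_open hU (fun w hw => by
    simp [h0 w fun i => by simpa using hw i (mem_univ i), hε])
  have h1 : ∀ᶠ a in l, ∀ i, 0 < ‖W a i‖ ∧ dist ‖W a i‖ 1 < δ :=
    eventually_all.2 fun i =>
      ((hW i).eventually_const_lt one_pos).and (Metric.tendsto_nhds.1 (hW i) δ hδ)
  filter_upwards [h1] with a ha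
  -- The radial projection to the torus moves each coordinate by `|‖W a i‖ - 1|`.
  refine hsub (mem_thickening_iff.2 ⟨fun i => W a i / ‖W a i‖, fun i _ => ?_, ?_⟩)
  · have := (ha i).1.ne'
    simp [this]
  · refine (dist_pi_lt_iff hδ).2 fun i => ?_
    have h2 : ((‖W a i‖ : ℝ) : ℂ) ≠ 0 := Complex.ofReal_ne_zero.2 (ha i).1.ne'
    have h3 : W a i - W a i / ‖W a i‖ = W a i / ‖W a i‖ * ((‖W a i‖ - 1 : ℝ) : ℂ) := by
      push_cast
      field_simp
    rw [dist_eq_norm, h3, norm_mul, norm_div, Complex.norm_real, norm_norm,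
      div_self (ha i).1.ne', one_mul, Complex.norm_real, ← dist_eq_norm]
    exact (ha i).2

theorem tendsto_zero_boundaryFilter {F : Type*} [NormedAddCommGroup F] {G : ℂ → F} (hG : Continuous G)
    (h0 : ∀ w : ℂ, ‖w‖ = 1 → G w = 0) : Tendsto G boundaryFilter (𝓝 0) :=
  tendsto_zero_of_tendsto_norm_one (W := fun z (_ : Unit) => z) (G := fun w => G (w ()))
    (fun _ => tendsto_norm_boundaryFilter) (hG.comp (continuous_apply ())) fun _ hw => h0 _ (hw ())

end BoundaryFilter

/-! ### Finite Blaschke products. -/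

section Blaschke

open Polynomial

theorem one_sub_conj_mul_ne_zero {a z : ℂ} (ha : ‖a‖ < 1) (hz : ‖z‖ ≤ 1) : 1 - conj a * z ≠ 0 := by
  intro h
  have h1 : ‖conj a * z‖ = 1 := by rw [← sub_eq_zero.1 h, norm_one]
  rw [norm_mul, RCLike.norm_conj] at h1
  nlinarith [norm_nonneg a, norm_nonneg z]

theorem sub_eq_mul_conj_one_sub (a : ℂ) {z : ℂ} (hz : ‖z‖ = 1) :
    z - a = z * conj (1 - conj a * z) := by
  have : z * conj z = 1 := by rw [Complex.mul_conj, Complex.normSq_eq_norm_sq, hz]; simp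
  simp only [map_sub, map_one, map_mul, Complex.conj_conj]
  linear_combination a * this

theorem norm_sub_lt_norm_one_sub_conj_mul {a z : ℂ} (ha : ‖a‖ < 1) (hz : ‖z‖ < 1) :
    ‖z - a‖ < ‖1 - conj a * z‖ := by
  refine lt_of_pow_lt_pow_left₀ 2 (norm_nonneg _) ?_
  have h1 : ‖1 - conj a * z‖ ^ 2 - ‖z - a‖ ^ 2 = (1 - ‖a‖ ^ 2) * (1 - ‖z‖ ^ 2) := by
    simp only [← Complex.normSq_eq_norm_sq, Complex.normSq_apply, Complex.sub_re, Complex.sub_im,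
      Complex.mul_re, Complex.mul_im, Complex.conj_re, Complex.conj_im, Complex.one_re,
      Complex.one_im]
    ring
  have h2 : 0 < (1 - ‖a‖ ^ 2) * (1 - ‖z‖ ^ 2) := by
    apply mul_pos <;> nlinarith [norm_nonneg a, norm_nonneg z]
  linarith

/-- `f` is a finite Blaschke product, written as a quotient of polynomials `p / q` with
`p(z) = c z ^ N conj(q(z))` on the unit circle. -/
def IsBlaschkeQuotient (f : ℂ → ℂ) : Prop :=
  ∃ (p q : ℂ[X]) (N : ℕ) (c : ℂ), c ≠ 0 ∧ (∀ z ∈ ball (0 : ℂ) 1, f z * q.eval z = p.eval z) ∧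
    (∀ z ∈ closedBall (0 : ℂ) 1, q.eval z ≠ 0) ∧
    ∀ z : ℂ, ‖z‖ = 1 → p.eval z = c * z ^ N * conj (q.eval z)

theorem tendsto_norm_one_sub_conj_mul_div {a : ℂ} (ha : ‖a‖ < 1) :
    Tendsto (fun z => ‖1 - conj a * z‖ / ‖z - a‖) boundaryFilter (𝓝 1) := by
  have hδ : 0 < (1 - ‖a‖) / 2 := by linarith
  have hmax (z : ℂ) : 0 < max ‖z - a‖ ((1 - ‖a‖) / 2) := lt_max_of_lt_right hδ
  -- The `max` removes the pole at `a`, making the function continuous on `ℂ`; near the circle it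
  -- changes nothing.
  have h1 : Tendsto (fun z => ‖1 - conj a * z‖ / max ‖z - a‖ ((1 - ‖a‖) / 2) - 1)
      boundaryFilter (𝓝 0) := by
    refine tendsto_zero_boundaryFilter ?_ fun z hz => ?_
    · exact (Continuous.div (by fun_prop) (by fun_prop) fun z => (hmax z).ne').sub continuous_const
    · have h2 : ‖z - a‖ = ‖1 - conj a * z‖ := by
        rw [sub_eq_mul_conj_one_sub a hz, norm_mul, hz, one_mul, RCLike.norm_conj]
      have h3 : (1 - ‖a‖) / 2 ≤ ‖z - a‖ := by
        have := norm_sub_norm_le z a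
        linarith
      rw [max_eq_left h3, h2, div_self, sub_self]
      exact norm_ne_zero_iff.2 (one_sub_conj_mul_ne_zero ha hz.le)
  have h4 : ∀ᶠ z : ℂ in boundaryFilter, (1 - ‖a‖) / 2 ≤ ‖z - a‖ := by
    have : (1 + ‖a‖) / 2 < 1 := by linarith
    filter_upwards [tendsto_norm_boundaryFilter.eventually_const_lt this] with z hz
    have := norm_sub_norm_le z a
    linarith
  have h5 := h1.add_const 1
  rw [zero_add] at h5
  refine h5.congr' ?_
  filter_upwards [h4] with z hz
  rw [max_eq_left hz, sub_add_cancel]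

/-- Zeros are divided out one Blaschke factor at a time. Each factor has modulus at most `ρ` at
`z₀`, whereas the quotient keeps modulus at most 1, so `ρ ^ k < ‖f z₀‖` bounds the number of zeros
and makes the induction on `k` stop. -/
theorem isBlaschkeQuotient_of_pow_lt {r ρ : ℝ} {z₀ : ℂ} (hz₀ : ‖z₀‖ < 1) (hρ : 0 ≤ ρ)
    (hr : r < 1)
    (hρz : ∀ a ∈ closedBall (0 : ℂ) r, ‖z₀ - a‖ ≤ ρ * ‖1 - conj a * z₀‖) (k : ℕ) :
    ∀ f : ℂ → ℂ, DifferentiableOn ℂ f (ball 0 1) →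
      Tendsto (fun z => ‖f z‖) boundaryFilter (𝓝 1) →
      (∀ z ∈ ball (0 : ℂ) 1, r < ‖z‖ → f z ≠ 0) → ρ ^ k < ‖f z₀‖ → IsBlaschkeQuotient f := by
  induction k with
  | zero =>
    intro f hf hlim _ hlt
    rw [pow_zero] at hlt
    exact absurd (norm_le_one_of_tendsto_boundaryFilter hf hlim (mem_ball_zero_iff.2 hz₀))
      (not_le.2 hlt)
  | succ k ih =>
    intro f hf hlim hne hlt
    by_cases h0 : ∀ z ∈ ball (0 : ℂ) 1, f z ≠ 0
    · obtain ⟨c, hc0, hc⟩ := exists_eq_const_of_tendsto_boundaryFilter hf hlim h0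
      exact ⟨C c, 1, 0, c, hc0, by simpa using hc, by simp, by simp⟩
    push Not at h0
    obtain ⟨a, ha, hfa⟩ := h0
    have har : ‖a‖ ≤ r := not_lt.1 fun h => hne a ha h hfa
    rw [mem_ball_zero_iff] at ha
    have hfd (z : ℂ) : f z = (z - a) * dslope f a z := by
      have := sub_smul_dslope f a z
      rw [hfa, sub_zero, smul_eq_mul] at this
      exact this.symm
    -- `f` divided by its Blaschke factor at `a`, extended holomorphically across `a` by `dslope`.
    set g : ℂ → ℂ := fun z => (1 - conj a * z) * dslope f a z with hg
    have hfg (z : ℂ) : f z * (1 - conj a * z) = (z - a) * g z := by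
      rw [hfd z, hg]
      ring
    have hgdiff : DifferentiableOn ℂ g (ball 0 1) := by
      refine DifferentiableOn.mul (by fun_prop) ?_
      exact (Complex.differentiableOn_dslope
        (isOpen_ball.mem_nhds (mem_ball_zero_iff.2 ha))).2 hf
    have hglim : Tendsto (fun z => ‖g z‖) boundaryFilter (𝓝 1) := by
      have h1 := hlim.mul (tendsto_norm_one_sub_conj_mul_div ha)
      rw [one_mul] at h1
      refine h1.congr' ?_
      filter_upwards [tendsto_norm_boundaryFilter.eventually_const_lt hr] with z hz
      have hza : ‖z - a‖ ≠ 0 := by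
        rw [norm_ne_zero_iff, sub_ne_zero]
        rintro rfl
        exact (har.trans_lt hz).false
      rw [← mul_div_assoc, div_eq_iff hza, ← norm_mul, ← norm_mul, hfg, mul_comm]
    have hgne (z : ℂ) (hz : z ∈ ball (0 : ℂ) 1) (hrz : r < ‖z‖) : g z ≠ 0 := by
      intro h
      have := hfg z
      rw [h, mul_zero, mul_eq_zero] at this
      exact this.elim (hne z hz hrz) (one_sub_conj_mul_ne_zero ha (mem_ball_zero_iff.1 hz).le)
    have hglt : ρ ^ k < ‖g z₀‖ := by
      have h1 : 0 < ‖1 - conj a * z₀‖ := norm_pos_iff.2 (one_sub_conj_mul_ne_zero ha hz₀.le)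
      have h2 : ‖f z₀‖ * ‖1 - conj a * z₀‖ = ‖z₀ - a‖ * ‖g z₀‖ := by
        rw [← norm_mul, ← norm_mul, hfg]
      have h3 := hρz a (mem_closedBall_zero_iff.2 har)
      have h4 : ‖f z₀‖ ≤ ρ * ‖g z₀‖ := by
        refine le_of_mul_le_mul_right ?_ h1
        rw [h2]
        nlinarith [norm_nonneg (g z₀)]
      have h5 : ρ * ρ ^ k < ρ * ‖g z₀‖ := by
        rw [← pow_succ']
        exact hlt.trans_le h4
      exact lt_of_mul_lt_mul_left h5 hρ
    obtain ⟨p, q, N, c, hc0, hpq, hq, hT⟩ := ih g hgdiff hglim hgne hglt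
    refine ⟨(X - C a) * p, (1 - C (conj a) * X) * q, N + 1, c, hc0, fun z hz => ?_,
      fun z hz => ?_, fun z hz => ?_⟩
    · simp only [eval_mul, eval_sub, eval_X, eval_C, eval_one, ← hpq z hz]
      linear_combination hfg z * q.eval z
    · simp only [eval_mul, eval_sub, eval_X, eval_C, eval_one]
      exact mul_ne_zero (one_sub_conj_mul_ne_zero ha (mem_closedBall_zero_iff.1 hz)) (hq z hz)
    · simp only [eval_mul, eval_sub, eval_X, eval_C, eval_one, hT z hz, map_mul]
      rw [sub_eq_mul_conj_one_sub a hz]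
      ring

/-- A holomorphic function on the disc whose modulus tends to one at the circle is a finite Blaschke
product. -/
theorem isBlaschkeQuotient_of_tendsto {f : ℂ → ℂ} (hf : DifferentiableOn ℂ f (ball 0 1))
    (hlim : Tendsto (fun z => ‖f z‖) boundaryFilter (𝓝 1)) : IsBlaschkeQuotient f := by
  obtain ⟨r, hr, hrf⟩ := eventually_boundaryFilter.1 (hlim.eventually_const_lt one_pos)
  obtain ⟨s, hs, hs1⟩ := exists_between (max_lt hr one_pos)
  rw [max_lt_iff] at hs
  have hsn : ‖(s : ℂ)‖ = s := by rw [Complex.norm_real, Real.norm_of_nonneg hs.2.le]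
  have hz₀ : ‖(s : ℂ)‖ < 1 := hsn.trans_lt hs1
  obtain ⟨ρ, hρ0, hρ1, hρ⟩ : ∃ ρ : ℝ, 0 ≤ ρ ∧ ρ < 1 ∧
      ∀ a ∈ closedBall (0 : ℂ) r, ‖(s : ℂ) - a‖ ≤ ρ * ‖1 - conj a * s‖ := by
    -- `r` may be negative. Otherwise `ρ` is the maximum over the compact ball of a continuous
    -- function with values below 1.
    rcases (closedBall (0 : ℂ) r).eq_empty_or_nonempty with he | hne
    · exact ⟨0, le_rfl, one_pos, by simp [he]⟩
    have ha1 {a : ℂ} (ha : a ∈ closedBall (0 : ℂ) r) : ‖a‖ < 1 :=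
      (mem_closedBall_zero_iff.1 ha).trans_lt hr
    have hpos {a : ℂ} (ha : a ∈ closedBall (0 : ℂ) r) : 0 < ‖1 - conj a * s‖ :=
      norm_pos_iff.2 (one_sub_conj_mul_ne_zero (ha1 ha) hz₀.le)
    have hcont : ContinuousOn (fun a : ℂ => ‖(s : ℂ) - a‖ / ‖1 - conj a * s‖)
        (closedBall 0 r) := by
      refine ContinuousOn.div ?_ ?_ fun a ha => (hpos ha).ne'
      · fun_prop
      · exact (continuous_const.sub (Complex.continuous_conj.mul continuous_const)).norm.continuousOn
    obtain ⟨a, ha, hmax⟩ := (isCompact_closedBall (0 : ℂ) r).exists_isMaxOn hne hcont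
    refine ⟨_, by positivity,
      (div_lt_one (hpos ha)).2 (norm_sub_lt_norm_one_sub_conj_mul (ha1 ha) hz₀), fun b hb => ?_⟩
    exact (div_le_iff₀ (hpos hb)).1 (hmax hb)
  have hfpos : 0 < ‖f s‖ := hrf s (hsn.symm ▸ hs.1) hz₀
  obtain ⟨k, hk⟩ := exists_pow_lt_of_lt_one hfpos hρ1
  exact isBlaschkeQuotient_of_pow_lt hz₀ hρ0 hr hρ k f hf hlim
    (fun z hz hrz => norm_pos_iff.1 (hrf z hrz (mem_ball_zero_iff.1 hz))) hk

end Blaschke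

/-! ### Rationality from asymptotic reflection at the circle. -/

section Rationality

open Polynomial

theorem norm_circleMap_zero {r : ℝ} (hr : 0 ≤ r) (θ : ℝ) : ‖circleMap 0 r θ‖ = r := by
  rw [_root_.norm_circleMap_zero, abs_of_nonneg hr]

/-- Cauchy's theorem for `z ^ n g`, with `dθ = dz / (i z)`. -/
theorem integral_circleMap_pow_mul_eq_zero {g : ℂ → ℂ} (hg : DifferentiableOn ℂ g (ball 0 1))
    {r : ℝ} (hr0 : 0 < r) (hr1 : r < 1) (n : ℕ) :
    ∫ θ in (0 : ℝ)..2 * Real.pi, circleMap 0 r θ ^ (n + 1) * g (circleMap 0 r θ) = 0 := by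
  have hd : DifferentiableOn ℂ (fun z => z ^ n * g z) (ball 0 1) := by fun_prop
  have h := (hd.diffContOnCl_ball (closedBall_subset_ball hr1)).circleIntegral_eq_zero hr0.le
  rw [circleIntegral] at h
  have h2 (θ : ℝ) : deriv (circleMap 0 r) θ • (circleMap 0 r θ ^ n * g (circleMap 0 r θ)) =
      Complex.I * (circleMap 0 r θ ^ (n + 1) * g (circleMap 0 r θ)) := by
    rw [deriv_circleMap, smul_eq_mul]
    ring
  simp_rw [h2] at h
  rw [intervalIntegral.integral_const_mul] at h
  exact (mul_eq_zero.1 h).resolve_left Complex.I_ne_zero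

/-- The conjugate of Cauchy's formula for the `n`-th derivative, since `z ^ n = r ^ (2 n) conj(z ^
(-n))` on the circle of radius `r`. -/
theorem integral_conj_circleMap_pow_mul {h : ℂ → ℂ} (hh : DifferentiableOn ℂ h (ball 0 1))
    {r : ℝ} (hr0 : 0 < r) (hr1 : r < 1) (n : ℕ) :
    ∫ θ in (0 : ℝ)..2 * Real.pi, circleMap 0 r θ ^ n * conj (h (circleMap 0 r θ)) =
      r ^ (2 * n) * conj (2 * Real.pi / n.factorial * iteratedDeriv n h 0) := by
  have h1 := (hh.mono (closedBall_subset_ball hr1)).circleIntegral_one_div_sub_center_pow_smul hr0 n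
  rw [circleIntegral] at h1
  have hne (θ : ℝ) : circleMap 0 r θ ≠ 0 := circleMap_ne_center hr0.ne'
  have h2 (θ : ℝ) : deriv (circleMap 0 r) θ •
      (1 / (circleMap 0 r θ - 0) ^ (n + 1)) • h (circleMap 0 r θ) =
      Complex.I * ((circleMap 0 r θ ^ n)⁻¹ * h (circleMap 0 r θ)) := by
    have := hne θ
    rw [deriv_circleMap, smul_eq_mul, smul_eq_mul, sub_zero]
    field_simp
    ring
  simp_rw [h2] at h1
  rw [intervalIntegral.integral_const_mul] at h1
  have h3 : ∫ θ in (0 : ℝ)..2 * Real.pi, (circleMap 0 r θ ^ n)⁻¹ * h (circleMap 0 r θ) =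
      2 * Real.pi / n.factorial * iteratedDeriv n h 0 := by
    refine mul_left_cancel₀ Complex.I_ne_zero (h1.trans ?_)
    rw [smul_eq_mul]
    ring
  have h4 (θ : ℝ) : circleMap 0 r θ ^ n * conj (h (circleMap 0 r θ)) =
      r ^ (2 * n) * conj ((circleMap 0 r θ ^ n)⁻¹ * h (circleMap 0 r θ)) := by
    have h5 : circleMap 0 r θ * conj (circleMap 0 r θ) = r ^ 2 := by
      rw [Complex.mul_conj, Complex.normSq_eq_norm_sq, norm_circleMap_zero hr0.le]
      simp
    have h6 : conj (circleMap 0 r θ) ≠ 0 := (_root_.map_ne_zero _).2 (hne θ)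
    rw [pow_mul, ← h5, map_mul, map_inv₀, map_pow, mul_pow]
    field_simp
  simp_rw [h4]
  rw [intervalIntegral.integral_const_mul, ← h3]
  congr 1
  exact intervalIntegral.intervalIntegral_conj

/-- If two holomorphic functions on the disc satisfy `c z ^ N conj(h(z)) = g(z)` asymptotically at
the circle, then `h` is a polynomial. -/
theorem exists_eval_eq_of_tendsto {h g : ℂ → ℂ} (hh : DifferentiableOn ℂ h (ball 0 1))
    (hg : DifferentiableOn ℂ g (ball 0 1)) {c : ℂ} (hc : c ≠ 0) {N : ℕ}
    (hlim : Tendsto (fun z => c * z ^ N * conj (h z) - g z) boundaryFilter (𝓝 0)) :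
    ∃ p : ℂ[X], ∀ z ∈ ball (0 : ℂ) 1, h z = p.eval z := by
  -- Integration against `z ^ (n + 1)` over a circle near the boundary kills `g` and isolates this
  -- derivative of `h`.
  have hzero (n : ℕ) : iteratedDeriv (N + n + 1) h 0 = 0 := by
    by_contra hne
    set A := ‖c‖ * ((1 / 2) ^ (2 * (N + n + 1)) *
      (2 * Real.pi / (N + n + 1).factorial * ‖iteratedDeriv (N + n + 1) h 0‖)) with hA
    have hApos : 0 < A := by
      have := norm_pos_iff.2 hne
      have := norm_pos_iff.2 hc
      have := Real.pi_pos
      positivity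
    -- This bound on the integrand gives an integral of modulus at most `A / 2`, while radii above
    -- `1 / 2` make it at least `A`.
    have hε : 0 < A / (4 * Real.pi) := by
      have := Real.pi_pos
      positivity
    obtain ⟨s, hs, hsP⟩ := eventually_boundaryFilter.1 (Metric.tendsto_nhds.1 hlim _ hε)
    obtain ⟨r, hr, hr1⟩ := exists_between (max_lt hs one_half_lt_one)
    rw [max_lt_iff] at hr
    have hr0 : 0 < r := one_half_pos.trans hr.2
    have hmem (θ : ℝ) : circleMap 0 r θ ∈ ball (0 : ℂ) 1 := by
      rw [mem_ball_zero_iff, norm_circleMap_zero hr0.le]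
      exact hr1
    have hcont {u : ℂ → ℂ} (hu : DifferentiableOn ℂ u (ball 0 1)) :
        Continuous fun θ => u (circleMap 0 r θ) :=
      hu.continuousOn.comp_continuous (continuous_circleMap 0 r) hmem
    have h1 : ∫ θ in (0 : ℝ)..2 * Real.pi, circleMap 0 r θ ^ (n + 1) *
        (c * circleMap 0 r θ ^ N * conj (h (circleMap 0 r θ)) - g (circleMap 0 r θ)) =
        c * (r ^ (2 * (N + n + 1)) * conj (2 * Real.pi / (N + n + 1).factorial *
          iteratedDeriv (N + n + 1) h 0)) := by
      have e (θ : ℝ) : circleMap 0 r θ ^ (n + 1) *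
          (c * circleMap 0 r θ ^ N * conj (h (circleMap 0 r θ)) - g (circleMap 0 r θ)) =
          c * (circleMap 0 r θ ^ (N + n + 1) * conj (h (circleMap 0 r θ))) -
            circleMap 0 r θ ^ (n + 1) * g (circleMap 0 r θ) := by ring
      simp_rw [e]
      have i1 : Continuous fun θ : ℝ =>
          c * (circleMap 0 r θ ^ (N + n + 1) * conj (h (circleMap 0 r θ))) :=
        continuous_const.mul (((continuous_circleMap 0 r).pow _).mul
          (Complex.continuous_conj.comp (hcont hh)))
      have i2 : Continuous fun θ : ℝ => circleMap 0 r θ ^ (n + 1) * g (circleMap 0 r θ) :=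
        ((continuous_circleMap 0 r).pow _).mul (hcont hg)
      rw [intervalIntegral.integral_sub (i1.intervalIntegrable _ _) (i2.intervalIntegrable _ _),
        intervalIntegral.integral_const_mul, integral_conj_circleMap_pow_mul hh hr0 hr1,
        integral_circleMap_pow_mul_eq_zero hg hr0 hr1, sub_zero]
    have h2 := intervalIntegral.norm_integral_le_of_norm_le_const (a := 0) (b := 2 * Real.pi)
      (C := A / (4 * Real.pi)) (f := fun θ => circleMap 0 r θ ^ (n + 1) *
        (c * circleMap 0 r θ ^ N * conj (h (circleMap 0 r θ)) - g (circleMap 0 r θ)))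
      (fun θ _ => by
        have h3 := (hsP (circleMap 0 r θ) (by rw [norm_circleMap_zero hr0.le]; exact hr.1)
          (by rw [norm_circleMap_zero hr0.le]; exact hr1)).le
        rw [dist_zero_right] at h3
        rw [norm_mul, norm_pow, norm_circleMap_zero hr0.le]
        calc _ ≤ 1 * (A / (4 * Real.pi)) :=
              mul_le_mul (pow_le_one₀ hr0.le hr1.le) h3 (norm_nonneg _) zero_le_one
          _ = _ := one_mul _)
    have hpi := Real.pi_pos
    have h4 : A / (4 * Real.pi) * |2 * Real.pi - 0| = A / 2 := by
      rw [sub_zero, abs_of_pos (by positivity)]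
      field_simp
      norm_num
    have h5 : A ≤ ‖c * (r ^ (2 * (N + n + 1)) * conj (2 * Real.pi / (N + n + 1).factorial *
          iteratedDeriv (N + n + 1) h 0))‖ := by
      simp only [norm_mul, RCLike.norm_conj, norm_pow, norm_div, Complex.norm_real,
        Complex.norm_natCast, Complex.norm_ofNat, Real.norm_of_nonneg hr0.le,
        Real.norm_of_nonneg hpi.le, hA]
      gcongr
      exact hr.2.le
    rw [h1, h4] at h2
    linarith
  refine ⟨∑ n ∈ Finset.range (N + 1), monomial n ((n.factorial : ℂ)⁻¹ * iteratedDeriv n h 0),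
    fun z hz => ?_⟩
  have hs := Complex.hasSum_taylorSeries_on_ball hh hz
  have hz' (n : ℕ) (hn : n ∉ Finset.range (N + 1)) :
      (n.factorial : ℂ)⁻¹ • (z - 0) ^ n • iteratedDeriv n h 0 = 0 := by
    obtain ⟨k, rfl⟩ := Nat.exists_eq_add_of_le (Nat.le_of_not_lt fun h => hn (Finset.mem_range.2 h))
    rw [add_right_comm, hzero]
    simp
  have hs' := hasSum_sum_of_ne_finset_zero (L := .unconditional ℕ) hz'
  rw [hs.unique hs', eval_finsetSum]
  refine Finset.sum_congr rfl fun n _ => ?_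
  rw [eval_monomial, sub_zero, smul_eq_mul, smul_eq_mul]
  ring

/-- If `f` is a finite Blaschke product `p / q` and `f conj(F) = G` asymptotically at the circle,
with `F` bounded, then `q F` is a polynomial. -/
theorem exists_eval_eq_mul_of_tendsto {f : ℂ → ℂ} {p q : ℂ[X]} {N : ℕ} {c : ℂ} (hc : c ≠ 0)
    (hpq : ∀ z ∈ ball (0 : ℂ) 1, f z * q.eval z = p.eval z)
    (hT : ∀ z : ℂ, ‖z‖ = 1 → p.eval z = c * z ^ N * conj (q.eval z))
    {F G : ℂ → ℂ} (hF : DifferentiableOn ℂ F (ball 0 1)) (hG : DifferentiableOn ℂ G (ball 0 1))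
    (hFb : ∃ M, ∀ z ∈ ball (0 : ℂ) 1, ‖F z‖ ≤ M)
    (hlim : Tendsto (fun z => f z * conj (F z) - G z) boundaryFilter (𝓝 0)) :
    ∃ h : ℂ[X], ∀ z ∈ ball (0 : ℂ) 1, q.eval z * F z = h.eval z := by
  refine exists_eval_eq_of_tendsto (h := fun z => q.eval z * F z) (g := fun z => q.eval z * G z)
    (q.differentiable.differentiableOn.mul hF) (q.differentiable.differentiableOn.mul hG)
    (N := N) hc ?_
  have h1 : Tendsto (fun z => p.eval z - c * z ^ N * conj (q.eval z)) boundaryFilter (𝓝 0) :=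
    tendsto_zero_boundaryFilter (p.continuous.sub ((continuous_const.mul (continuous_pow N)).mul
      (Complex.continuous_conj.comp q.continuous))) fun z hz => by rw [hT z hz, sub_self]
  have hFb' : IsBoundedUnder (· ≤ ·) boundaryFilter (norm ∘ fun z => conj (F z)) := by
    obtain ⟨M, hM⟩ := hFb
    refine ⟨M, ?_⟩
    rw [eventually_map]
    filter_upwards [eventually_boundaryFilter_mem_ball] with z hz
    simpa using hM z hz
  have hqb : IsBoundedUnder (· ≤ ·) boundaryFilter (norm ∘ fun z => q.eval z) := by
    obtain ⟨M, hM⟩ := (isCompact_closedBall (0 : ℂ) 1).exists_bound_of_continuousOn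
      q.continuous.continuousOn
    refine ⟨M, ?_⟩
    rw [eventually_map]
    filter_upwards [eventually_boundaryFilter_mem_ball] with z hz
    exact hM z (ball_subset_closedBall hz)
  -- As `f q = p`, the target `c z ^ N conj(q F) - q G` equals `q (f conj(F) - G) - (p - c z ^ N
  -- conj(q)) conj(F)`.
  have h2 := (isBoundedUnder_le_mul_tendsto_zero hqb hlim).sub (h1.zero_mul_isBoundedUnder_le hFb')
  rw [sub_zero] at h2
  refine h2.congr' ?_
  filter_upwards [eventually_boundaryFilter_mem_ball] with z hz
  simp only [← hpq z hz, map_mul]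
  ring

end Rationality

/-! ### Eigenvalues of contractive holomorphic operator functions. -/

section Contractions

open Polynomial

variable {E : Type*} [NormedAddCommGroup E] [InnerProductSpace ℂ E]

/-- The equality case of Cauchy–Schwarz: `‖B v - μ v‖² = ‖B v‖² - ‖v‖² ≤ 0`. -/
theorem apply_eq_smul_of_inner_eq {B : E →L[ℂ] E} (hB : ‖B‖ ≤ 1) {v : E} {μ : ℂ} (hμ : ‖μ‖ = 1)
    (h : inner ℂ v (B v) = μ * ‖v‖ ^ 2) : B v = μ • v := by
  have h1 : ‖B v‖ ≤ ‖v‖ := by simpa using B.le_of_opNorm_le hB v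
  have h2 : ‖B v - μ • v‖ ^ 2 = ‖B v‖ ^ 2 - ‖v‖ ^ 2 := by
    have h3 : inner ℂ (μ • v) (B v) = ((‖v‖ ^ 2 : ℝ) : ℂ) := by
      rw [inner_smul_left, h, ← mul_assoc, Complex.conj_mul', hμ]
      push_cast
      ring
    have h4 : RCLike.re (inner ℂ (B v) (μ • v)) = ‖v‖ ^ 2 := by
      rw [inner_re_symm, h3]
      exact Complex.ofReal_re _
    rw [norm_sub_sq (𝕜 := ℂ), h4, norm_smul, hμ]
    ring
  have h5 : ‖B v - μ • v‖ ^ 2 ≤ 0 := by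
    rw [h2]
    nlinarith [norm_nonneg (B v)]
  rw [← sub_eq_zero, ← norm_eq_zero]
  exact pow_eq_zero_iff two_ne_zero |>.1 (le_antisymm h5 (sq_nonneg _))

/-- A unimodular eigenvalue of a contractive holomorphic operator function at one point is an
eigenvalue everywhere, with the same eigenvector. -/
theorem IsContractiveHolomorphic.apply_eq_smul {Ψ : ℂ → E →L[ℂ] E}
    (hΨ : IsContractiveHolomorphic Ψ) {z₀ : ℂ} (hz₀ : z₀ ∈ ball (0 : ℂ) 1) {v : E} {μ : ℂ}
    (hμ : ‖μ‖ = 1) (h : Ψ z₀ v = μ • v) {z : ℂ} (hz : z ∈ ball (0 : ℂ) 1) : Ψ z v = μ • v := by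
  have hd : DifferentiableOn ℂ (fun z => inner ℂ v (Ψ z v)) (ball 0 1) :=
    (innerSL ℂ v).differentiable.comp_differentiableOn (hΨ.1.clm_apply (differentiableOn_const v))
  have h0 : inner ℂ v (Ψ z₀ v) = μ * ‖v‖ ^ 2 := by
    rw [h, inner_smul_right, inner_self_eq_norm_sq_to_K]
    simp
  refine apply_eq_smul_of_inner_eq (hΨ.2 z hz) hμ ?_
  rw [← h0]
  -- `⟨v, Ψ z v⟩` attains its largest possible modulus `‖v‖²` at `z₀`, so it is constant.
  refine Complex.eqOn_of_isPreconnected_of_isMaxOn_norm (convex_ball 0 1).isPreconnected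
    isOpen_ball hd hz₀ (fun u hu => ?_) hz
  have h1 : ‖Ψ u v‖ ≤ ‖v‖ := by simpa using (Ψ u).le_of_opNorm_le (hΨ.2 u hu) v
  simp only [Function.comp_apply, mem_ofPred_eq]
  rw [h0, norm_mul, hμ, one_mul, norm_pow, Complex.norm_real, norm_norm]
  calc _ ≤ ‖v‖ * ‖Ψ u v‖ := norm_inner_le_norm _ _
    _ ≤ ‖v‖ ^ 2 := by rw [sq]; gcongr

variable [FiniteDimensional ℂ E]

/-- `v` is also an eigenvector of the adjoint, for `conj μ`. Hence the orthogonal complement of `v`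
is invariant under `A`. -/
theorem inner_apply_of_apply_eq_smul {A : E →L[ℂ] E} (hA : ‖A‖ ≤ 1) {v : E} {μ : ℂ}
    (hμ : ‖μ‖ = 1) (h : A v = μ • v) (u : E) : inner ℂ v (A u) = μ * inner ℂ v u := by
  have : CompleteSpace E := FiniteDimensional.complete ℂ E
  have h1 : ContinuousLinearMap.adjoint A v = conj μ • v := by
    refine apply_eq_smul_of_inner_eq (by rwa [LinearIsometryEquiv.norm_map])
      (by rwa [RCLike.norm_conj]) ?_
    rw [ContinuousLinearMap.adjoint_inner_right, h, inner_smul_left, inner_self_eq_norm_sq_to_K]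
    simp
  rw [← ContinuousLinearMap.adjoint_inner_left, h1, inner_smul_left, Complex.conj_conj]

/-- The coefficients of the characteristic polynomial depend holomorphically on the operator. -/
theorem differentiableOn_charpoly_coeff {Ψ : ℂ → E →L[ℂ] E} {s : Set ℂ}
    (hΨ : DifferentiableOn ℂ Ψ s) (k : ℕ) :
    DifferentiableOn ℂ (fun z => (LinearMap.charpoly (Ψ z : E →ₗ[ℂ] E)).coeff k) s := by
  let b := stdOrthonormalBasis ℂ E
  let n := Fin (Module.finrank ℂ E)
  let M : ℂ → n × n → ℂ := fun z ij => inner ℂ (b ij.1) (Ψ z (b ij.2))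
  have hM : DifferentiableOn ℂ M s := by
    refine differentiableOn_pi.2 fun ij => ?_
    exact (innerSL ℂ (b ij.1)).differentiable.comp_differentiableOn
      (hΨ.clm_apply (differentiableOn_const _))
  have h1 (z : ℂ) : (LinearMap.charpoly (Ψ z : E →ₗ[ℂ] E)).coeff k =
      MvPolynomial.eval (M z) ((Matrix.charpoly.univ ℂ n).coeff k) := by
    have h2 : LinearMap.toMatrix b.toBasis b.toBasis (Ψ z : E →ₗ[ℂ] E) =
        Matrix.of (M z).curry := by
      ext i j
      simp [LinearMap.toMatrix_apply, M, OrthonormalBasis.repr_apply_apply]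
    rw [← LinearMap.charpoly_toMatrix _ b.toBasis, h2,
      ← Matrix.charpoly.univ_coeff_eval₂Hom n (RingHom.id ℂ)]
    rfl
  simp_rw [h1]
  exact (AnalyticOnNhd.eval_mvPolynomial _).differentiableOn.comp hM (mapsTo_univ _ _)

/-- The eigenvalues in the open disc of a contractive holomorphic operator function are the roots of
a holomorphic family of monic polynomials with all their roots in the open disc. -/
theorem IsContractiveHolomorphic.exists_monic_family (d : ℕ) : ∀ {E : Type*}
    [NormedAddCommGroup E] [InnerProductSpace ℂ E] [FiniteDimensional ℂ E]
    (_ : Module.finrank ℂ E = d) {Ψ : ℂ → E →L[ℂ] E} (_ : IsContractiveHolomorphic Ψ),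
    ∃ (m : ℕ) (P : ℂ → ℂ[X]), (∀ k, DifferentiableOn ℂ (fun z => (P z).coeff k) (ball 0 1)) ∧
      ∀ z ∈ ball (0 : ℂ) 1, (P z).Monic ∧ (P z).natDegree = m ∧
        (∀ w, (P z).eval w = 0 → ‖w‖ < 1) ∧
        ∀ w, ‖w‖ < 1 → ((∃ u ≠ 0, Ψ z u = w • u) ↔ (P z).eval w = 0) := by
  induction d using Nat.strong_induction_on with
  | _ d ih =>
  intro E _ _ _ hd Ψ hΨ
  by_cases hu : ∃ z₀ ∈ ball (0 : ℂ) 1, ∃ v ≠ 0, ∃ μ : ℂ, ‖μ‖ = 1 ∧ Ψ z₀ v = μ • v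
  · obtain ⟨z₀, hz₀, v, hv, μ, hμ, hμv⟩ := hu
    have hz {z : ℂ} (hz : z ∈ ball (0 : ℂ) 1) : Ψ z v = μ • v := hΨ.apply_eq_smul hz₀ hμ hμv hz
    -- Restricting to this invariant subspace lowers the dimension and loses no eigenvector for an
    -- eigenvalue in the open disc: such an eigenvalue differs from `μ`, so its eigenvectors are
    -- orthogonal to `v`.
    let F : Submodule ℂ E := (ℂ ∙ v)ᗮ
    have hF (u : E) : u ∈ F ↔ inner ℂ v u = 0 := Submodule.mem_orthogonal_singleton_iff_inner_right
    have hlt : Module.finrank ℂ F < d := by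
      rw [← hd]
      refine Submodule.finrank_lt fun htop => hv ?_
      have : v ∈ F := by rw [htop]; trivial
      exact inner_self_eq_zero.1 ((hF v).1 this)
    let Ψ' : ℂ → F →L[ℂ] F := fun z => F.orthogonalProjectionOnto ∘L (Ψ z ∘L F.subtypeL)
    have hinv {z : ℂ} (hzb : z ∈ ball (0 : ℂ) 1) (u : F) : Ψ z u ∈ F := by
      rw [hF, inner_apply_of_apply_eq_smul (hΨ.2 z hzb) hμ (hz hzb), (hF u).1 u.2, mul_zero]
    have hΨ'_apply {z : ℂ} (hzb : z ∈ ball (0 : ℂ) 1) (u : F) : (Ψ' z u : E) = Ψ z u :=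
      congrArg Subtype.val (F.orthogonalProjectionOnto_mem_subspace_eq_self ⟨Ψ z u, hinv hzb u⟩)
    have hΨ' : IsContractiveHolomorphic Ψ' := by
      refine ⟨(differentiableOn_const _).clm_comp (hΨ.1.clm_comp (differentiableOn_const _)),
        fun z hzb => ContinuousLinearMap.opNorm_le_bound _ zero_le_one fun u => ?_⟩
      rw [← Submodule.norm_coe, hΨ'_apply hzb]
      exact (Ψ z).le_of_opNorm_le (hΨ.2 z hzb) u
    obtain ⟨m, P, hP, hPz⟩ := ih _ hlt rfl hΨ'
    refine ⟨m, P, hP, fun z hzb => ?_⟩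
    obtain ⟨h1, h2, h3, h4⟩ := hPz z hzb
    refine ⟨h1, h2, h3, fun w hw => (Iff.trans ⟨?_, ?_⟩ (h4 w hw))⟩
    · rintro ⟨u, hu0, huw⟩
      have huF : u ∈ F := by
        rw [hF]
        have h5 := inner_apply_of_apply_eq_smul (hΨ.2 z hzb) hμ (hz hzb) u
        rw [huw, inner_smul_right] at h5
        have h6 : w ≠ μ := by
          rintro rfl
          exact hw.ne hμ
        exact (mul_eq_mul_right_iff.1 h5).resolve_left h6
      refine ⟨⟨u, huF⟩, fun h => hu0 (congrArg Subtype.val h), Subtype.ext ?_⟩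
      rw [hΨ'_apply hzb]
      exact huw
    · rintro ⟨u, hu0, huw⟩
      refine ⟨u, fun h => hu0 (Subtype.ext h), ?_⟩
      rw [← hΨ'_apply hzb, huw]
      rfl
  -- Without unimodular eigenvalues the characteristic polynomial itself has all its roots in the
  -- open disc.
  · push Not at hu
    have hroot (z w : ℂ) : (∃ u ≠ 0, Ψ z u = w • u) ↔
        (LinearMap.charpoly (Ψ z : E →ₗ[ℂ] E)).eval w = 0 := by
      rw [← Polynomial.IsRoot.def, ← Module.End.hasEigenvalue_iff_isRoot_charpoly]
      constructor
      · rintro ⟨u, hu0, huw⟩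
        exact Module.End.hasEigenvalue_of_hasEigenvector
          ⟨Module.End.mem_eigenspace_iff.2 huw, hu0⟩
      · intro h
        obtain ⟨u, hu⟩ := h.exists_hasEigenvector
        exact ⟨u, hu.2, hu.apply_eq_smul⟩
    refine ⟨Module.finrank ℂ E, fun z => LinearMap.charpoly (Ψ z : E →ₗ[ℂ] E),
      differentiableOn_charpoly_coeff hΨ.1, fun z hz => ⟨LinearMap.charpoly_monic _,
      LinearMap.charpoly_natDegree _, fun w hw => ?_, fun w _ => hroot z w⟩⟩
    obtain ⟨u, hu0, huw⟩ := (hroot z w).2 hw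
    refine lt_of_le_of_ne ?_ fun h => hu z hz u hu0 w h huw
    have h1 := (Ψ z).le_of_opNorm_le (hΨ.2 z hz) u
    rw [huw, norm_smul] at h1
    exact le_of_mul_le_mul_right h1 (norm_pos_iff.2 hu0)

theorem mem_detVariety_iff {Ψ : ℂ → E →L[ℂ] E} {x : ℂ × ℂ} :
    x ∈ detVariety Ψ ↔ x ∈ openBidisc ∧ ∃ u ≠ 0, Ψ x.1 u = x.2 • u := by
  refine and_congr_right fun _ => ?_
  rw [ContinuousLinearMap.det, LinearMap.det_eq_zero_iff_ker_ne_bot, Submodule.ne_bot_iff]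
  constructor
  · rintro ⟨u, hu, hu0⟩
    exact ⟨u, hu0, sub_eq_zero.1 hu⟩
  · rintro ⟨u, hu0, hu⟩
    exact ⟨u, sub_eq_zero.2 hu, hu0⟩

end Contractions

/-! ### Coefficients of a monic polynomial as functions of its roots. -/

section Roots

open Polynomial

theorem exists_eq_prod_X_sub_C {P : ℂ[X]} (hP : P.Monic) {m : ℕ} (hm : P.natDegree = m) :
    ∃ w : Fin m → ℂ, P = ∏ i, (X - C (w i)) := by
  have hs := IsAlgClosed.splits P
  have hlen : P.roots.toList.length = m := by
    rw [Multiset.length_toList, ← hs.natDegree_eq_card_roots, hm]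
  subst hlen
  refine ⟨fun i => P.roots.toList[i], ?_⟩
  conv_lhs => rw [hs.eq_prod_roots_of_monic hP, ← P.roots.coe_toList, Multiset.map_coe,
    Multiset.prod_coe]
  exact (Fin.prod_univ_fun_getElem P.roots.toList fun a => X - C a).symm

theorem continuous_coeff_prod_X_sub_C {ι : Type*} (s : Finset ι) (k : ℕ) :
    Continuous fun w : ι → ℂ => (∏ i ∈ s, (X - C (w i))).coeff k := by
  classical
  induction s using Finset.induction_on generalizing k with
  | empty => exact continuous_const
  | insert a s ha ih =>
    simp only [Finset.prod_insert ha, sub_mul, coeff_sub, coeff_C_mul]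
    cases k with
    | zero =>
      simp only [coeff_X_mul_zero]
      exact continuous_const.sub ((continuous_apply a).mul (ih 0))
    | succ k =>
      simp only [coeff_X_mul]
      exact (ih k).sub ((continuous_apply a).mul (ih (k + 1)))

/-- A factor with unimodular root is self-reciprocal, `X - w = -w (1 - conj(w) X)`, and this
symmetry is multiplicative. -/
theorem coeff_prod_X_sub_C_of_norm_eq_one {ι : Type*} (w : ι → ℂ) (hw : ∀ i, ‖w i‖ = 1)
    (s : Finset ι) : ∀ i j, i + j = s.card →
      (∏ i ∈ s, (X - C (w i))).coeff 0 * conj ((∏ i ∈ s, (X - C (w i))).coeff j) =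
        (∏ i ∈ s, (X - C (w i))).coeff i := by
  classical
  induction s using Finset.induction_on with
  | empty =>
    intro i j hij
    obtain ⟨rfl, rfl⟩ : i = 0 ∧ j = 0 := by simpa using hij
    simp
  | insert a s ha ih =>
    intro i j hij
    rw [Finset.card_insert_of_notMem ha] at hij
    have hw1 : w a * conj (w a) = 1 := by rw [Complex.mul_conj']; simp [hw a]
    have hdeg : (∏ i ∈ s, (X - C (w i))).coeff (s.card + 1) = 0 := by
      refine coeff_eq_zero_of_natDegree_lt ?_
      rw [natDegree_prod_of_monic _ _ fun i _ => monic_X_sub_C _]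
      simp
    simp only [Finset.prod_insert ha, sub_mul, coeff_sub, coeff_C_mul, coeff_X_mul_zero]
    set Q := ∏ i ∈ s, (X - C (w i))
    rcases i with _ | i <;> rcases j with _ | j
    · omega
    · obtain rfl : j = s.card := by omega
      have := ih 0 s.card (by omega)
      simp only [coeff_X_mul, coeff_X_mul_zero, hdeg]
      simp only [mul_zero, sub_zero, zero_sub]
      linear_combination -w a * this
    · obtain rfl : i = s.card := by omega
      have := ih s.card 0 (by omega)
      simp only [coeff_X_mul, coeff_X_mul_zero, hdeg]
      simp only [mul_zero, sub_zero, zero_sub, map_neg, map_mul]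
      linear_combination this + Q.coeff 0 * conj (Q.coeff 0) * hw1
    · have h1 := ih i (j + 1) (by omega)
      have h2 := ih (i + 1) j (by omega)
      simp only [coeff_X_mul, map_sub, map_mul]
      linear_combination h1 - w a * h2 + Q.coeff 0 * conj (Q.coeff (j + 1)) * hw1

end Roots

/-! ### Algebraicity and polynomial convexity of the closure. -/

section DistinguishedVariety

open Polynomial

theorem polyEval_aeval_X_zero (h : ℂ[X]) (x : ℂ × ℂ) :
    polyEval (Polynomial.aeval (MvPolynomial.X 0) h) x = h.eval x.1 := by
  induction h using Polynomial.induction_on' with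
  | add p q hp hq =>
    rw [map_add, eval_add, ← hp, ← hq]
    simp [polyEval]
  | monomial n a => simp [polyEval, Polynomial.aeval_monomial, MvPolynomial.algebraMap_eq]

/-- The part of a distinguished variety over points near the unit circle is near the torus. -/
theorem IsDistinguished.tendsto_norm {V : Set (ℂ × ℂ)} (hV : IsDistinguished V) {w : ℂ → ℂ}
    (hw : ∀ z ∈ ball (0 : ℂ) 1, (z, w z) ∈ V) :
    Tendsto (fun z => ‖w z‖) boundaryFilter (𝓝 1) := by
  have hw1 {z : ℂ} (hz : z ∈ ball (0 : ℂ) 1) : ‖w z‖ < 1 :=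
    mem_ball_zero_iff.1 (hV.1 (hw z hz)).2
  rw [tendsto_order]
  constructor
  · intro t ht
    have hK : IsCompact (closure V ∩ {x | ‖x.2‖ ≤ t}) := by
      refine IsCompact.inter_right ?_ (isClosed_le (by fun_prop) continuous_const)
      exact (((isBounded_ball (x := (0 : ℂ)) (r := 1)).prod isBounded_ball).subset
        hV.1).isCompact_closure
    -- A point of the closure outside the bidisc has `|w| = 1 > t`. By compactness the slice `|w| ≤
    -- t` then stays over a smaller disc.
    have hlt : ∀ x ∈ closure V ∩ {x | ‖x.2‖ ≤ t}, ‖x.1‖ < 1 := by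
      rintro x ⟨hx, hxt⟩
      by_cases hxb : x ∈ openBidisc
      · exact mem_ball_zero_iff.1 hxb.1
      · have := mem_sphere_zero_iff_norm.1 (hV.2.2 ⟨hx, hxb⟩).2
        exact absurd hxt (not_le.2 (this ▸ ht))
    obtain ⟨r, hr, hrK⟩ : ∃ r < 1, ∀ x ∈ closure V ∩ {x | ‖x.2‖ ≤ t}, ‖x.1‖ ≤ r := by
      rcases (closure V ∩ {x | ‖x.2‖ ≤ t}).eq_empty_or_nonempty with he | hne
      · exact ⟨0, one_pos, by simp [he]⟩
      · obtain ⟨x, hx, hmax⟩ := hK.exists_isMaxOn hne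
          (f := fun x : ℂ × ℂ => ‖x.1‖) (by fun_prop)
        exact ⟨_, hlt x hx, hmax⟩
    refine eventually_boundaryFilter.2 ⟨r, hr, fun z hz hz1 => ?_⟩
    by_contra! h
    exact absurd (hrK _ ⟨subset_closure (hw z (mem_ball_zero_iff.2 hz1)), h⟩) (not_le.2 hz)
  · intro t ht
    filter_upwards [eventually_boundaryFilter_mem_ball] with z hz
    exact (hw1 hz).trans ht

/-- The defining family of a distinguished variety is a polynomial up to a factor without zeros on
the closed disc. -/
theorem exists_polyEval_eq_mul {m : ℕ} {P : ℂ → ℂ[X]} {W : ℂ → Fin m → ℂ}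
    (hP : ∀ k, DifferentiableOn ℂ (fun z => (P z).coeff k) (ball 0 1))
    (hPW : ∀ z ∈ ball (0 : ℂ) 1, P z = ∏ i, (X - C (W z i)))
    (hW1 : ∀ z ∈ ball (0 : ℂ) 1, ∀ i, ‖W z i‖ ≤ 1)
    (hWlim : ∀ i, Tendsto (fun z => ‖W z i‖) boundaryFilter (𝓝 1)) :
    ∃ (ψ : MvPolynomial (Fin 2) ℂ) (q : ℂ[X]), (∀ z ∈ closedBall (0 : ℂ) 1, q.eval z ≠ 0) ∧
      ∀ z ∈ ball (0 : ℂ) 1, ∀ w, polyEval ψ (z, w) = q.eval z * ∏ i, (w - W z i) := by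
  let Q : (Fin m → ℂ) → ℂ[X] := fun w => ∏ i, (X - C (w i))
  have hQ (k) : Continuous fun w => (Q w).coeff k := continuous_coeff_prod_X_sub_C _ k
  have hcoeff0 : Tendsto (fun z => ‖(P z).coeff 0‖) boundaryFilter (𝓝 1) := by
    have h1 := tendsto_zero_of_tendsto_norm_one hWlim (G := fun w => ‖(Q w).coeff 0‖ - 1)
      ((hQ 0).norm.sub continuous_const) fun w hw => by
        simp [Q, coeff_zero_eq_eval_zero, eval_prod, hw]
    have h2 := h1.add_const 1
    simp only [sub_add_cancel, zero_add] at h2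
    refine h2.congr' ?_
    filter_upwards [eventually_boundaryFilter_mem_ball] with z hz
    rw [hPW z hz]
  obtain ⟨p, q, N, c, hc, hpq, hq, hT⟩ := isBlaschkeQuotient_of_tendsto (hP 0) hcoeff0
  have hbound (k) : ∃ M, ∀ z ∈ ball (0 : ℂ) 1, ‖(P z).coeff k‖ ≤ M := by
    obtain ⟨M, hM⟩ := (isCompact_univ_pi fun _ : Fin m =>
      isCompact_closedBall (0 : ℂ) 1).exists_bound_of_continuousOn (hQ k).continuousOn
    refine ⟨M, fun z hz => ?_⟩
    rw [hPW z hz]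
    exact hM (W z) fun i _ => mem_closedBall_zero_iff.2 (hW1 z hz i)
  -- The self-reciprocity of the coefficients holds exactly for unimodular roots, hence
  -- asymptotically at the circle, where it provides the reflection relation between `a_k` and
  -- `a_(m-k)`.
  have hpoly (k : ℕ) (hk : k ≤ m) :
      ∃ h : ℂ[X], ∀ z ∈ ball (0 : ℂ) 1, q.eval z * (P z).coeff k = h.eval z := by
    refine exists_eval_eq_mul_of_tendsto hc hpq hT (hP k) (hP (m - k)) (hbound k) ?_
    have h1 := tendsto_zero_of_tendsto_norm_one hWlim
      (G := fun w => (Q w).coeff 0 * conj ((Q w).coeff k) - (Q w).coeff (m - k))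
      (((hQ 0).mul (Complex.continuous_conj.comp (hQ k))).sub (hQ _)) fun w hw =>
        sub_eq_zero.2 (coeff_prod_X_sub_C_of_norm_eq_one w hw Finset.univ (m - k) k (by simp [hk]))
    refine h1.congr' ?_
    filter_upwards [eventually_boundaryFilter_mem_ball] with z hz
    rw [hPW z hz]
  choose! h hh using hpoly
  refine ⟨∑ k ∈ Finset.range (m + 1),
    Polynomial.aeval (MvPolynomial.X 0) (h k) * MvPolynomial.X 1 ^ k, q, hq, fun z hz w => ?_⟩
  have h1 : ∏ i, (w - W z i) = ∑ k ∈ Finset.range (m + 1), (P z).coeff k * w ^ k := by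
    have h2 : (P z).natDegree = m := by
      rw [hPW z hz, natDegree_prod_of_monic _ _ fun i _ => monic_X_sub_C _]
      simp
    have h3 := (P z).eval_eq_sum_range w
    rw [h2] at h3
    rw [← h3, hPW z hz, eval_prod]
    simp
  have h4 (k : ℕ) : MvPolynomial.eval ![z, w] (Polynomial.aeval (MvPolynomial.X 0) (h k)) =
      (h k).eval z := polyEval_aeval_X_zero (h k) (z, w)
  simp only [polyEval, map_sum, map_mul, map_pow, MvPolynomial.eval_X, h4]
  rw [h1, Finset.mul_sum]
  refine Finset.sum_congr rfl fun k hk => ?_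
  rw [← hh k (Nat.lt_succ_iff.1 (Finset.mem_range.1 hk)) z hz, mul_assoc]
  rfl

/-- If `ψ(z, w) = q(z) ∏ (w - Wᵢ(z))` on the disc, with `q` zero-free on the closed disc, then every
zero of `ψ` over the unit circle is a limit of points `(z, Wᵢ(z))`. -/
theorem mem_closure_of_polyEval_eq_zero {m : ℕ} {W : ℂ → Fin m → ℂ} {V : Set (ℂ × ℂ)}
    (hWV : ∀ z ∈ ball (0 : ℂ) 1, ∀ i, (z, W z i) ∈ V)
    {ψ : MvPolynomial (Fin 2) ℂ} {q : ℂ[X]} (hq : ∀ z ∈ closedBall (0 : ℂ) 1, q.eval z ≠ 0)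
    (hψ : ∀ z ∈ ball (0 : ℂ) 1, ∀ w, polyEval ψ (z, w) = q.eval z * ∏ i, (w - W z i))
    {z₀ w₀ : ℂ} (hz₀ : z₀ ∈ closedBall (0 : ℂ) 1) (h0 : polyEval ψ (z₀, w₀) = 0) :
    (z₀, w₀) ∈ closure V := by
  rw [Metric.mem_closure_iff]
  intro ε hε
  by_contra! hfar
  have hne : (𝓝[ball (0 : ℂ) 1] z₀).NeBot := by
    rw [← mem_closure_iff_nhdsWithin_neBot, closure_ball _ one_ne_zero]
    exact hz₀
  have h1 : Tendsto (fun z => ‖polyEval ψ (z, w₀)‖) (𝓝[ball (0 : ℂ) 1] z₀) (𝓝 0) := by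
    have : Continuous fun z : ℂ => ‖polyEval ψ (z, w₀)‖ :=
      ((continuous_polyEval ψ).comp (Continuous.prodMk_left w₀)).norm
    have h2 := this.tendsto z₀
    rw [h0, norm_zero] at h2
    exact h2.mono_left nhdsWithin_le_nhds
  have h2 : Tendsto (fun z => ‖q.eval z‖ * ε ^ m) (𝓝[ball (0 : ℂ) 1] z₀)
      (𝓝 (‖q.eval z₀‖ * ε ^ m)) :=
    ((q.continuous.norm.mul continuous_const).tendsto z₀).mono_left nhdsWithin_le_nhds
  -- If `V` stays at distance `ε` from `(z₀, w₀)`, every root over `z` near `z₀` is at distance at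
  -- least `ε` from `w₀`.
  have h3 : ∀ᶠ z in 𝓝[ball (0 : ℂ) 1] z₀, ‖q.eval z‖ * ε ^ m ≤ ‖polyEval ψ (z, w₀)‖ := by
    filter_upwards [self_mem_nhdsWithin, nhdsWithin_le_nhds (ball_mem_nhds z₀ hε)] with z hz hzε
    rw [hψ z hz, norm_mul, norm_prod]
    gcongr
    calc ε ^ m = ∏ _i : Fin m, ε := by simp
      _ ≤ _ := by
        refine Finset.prod_le_prod (fun _ _ => hε.le) fun i _ => ?_
        have h4 := hfar _ (hWV z hz i)
        rw [Prod.dist_eq, le_max_iff] at h4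
        rw [← dist_eq_norm]
        refine h4.resolve_left (not_le.2 ?_)
        rw [dist_comm]
        exact hzε
  have h4 := le_of_tendsto_of_tendsto h2 h1 h3
  have h5 : 0 < ‖q.eval z₀‖ * ε ^ m := mul_pos (norm_pos_iff.2 (hq z₀ hz₀)) (pow_pos hε m)
  exact absurd h4 (not_le.2 h5)

variable {E : Type*} [NormedAddCommGroup E] [InnerProductSpace ℂ E] [FiniteDimensional ℂ E]

/-- The closure of a distinguished variety is algebraic in the closed bidisc. -/
theorem exists_closure_detVariety_eq {Ψ : ℂ → E →L[ℂ] E} (hΨ : IsContractiveHolomorphic Ψ)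
    (hV : IsDistinguished (detVariety Ψ)) :
    ∃ ψ : MvPolynomial (Fin 2) ℂ,
      closure (detVariety Ψ) = {x | x ∈ closedBidisc ∧ polyEval ψ x = 0} := by
  obtain ⟨m, P, hP, hPz⟩ := IsContractiveHolomorphic.exists_monic_family _ rfl hΨ
  have hex (z : ℂ) (hz : z ∈ ball (0 : ℂ) 1) : ∃ w : Fin m → ℂ, P z = ∏ i, (X - C (w i)) :=
    exists_eq_prod_X_sub_C (hPz z hz).1 (hPz z hz).2.1
  -- The roots are labelled separately over each `z`, with no continuity; only their moduli and
  -- symmetric functions matter.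
  choose! W hW using hex
  have heval {z : ℂ} (hz : z ∈ ball (0 : ℂ) 1) (w : ℂ) : (P z).eval w = ∏ i, (w - W z i) := by
    rw [hW z hz, eval_prod]
    simp
  have hroot {z : ℂ} (hz : z ∈ ball (0 : ℂ) 1) (i : Fin m) : (P z).eval (W z i) = 0 := by
    rw [heval hz]
    exact Finset.prod_eq_zero (Finset.mem_univ i) (sub_self _)
  have hmem {z : ℂ} (hz : z ∈ ball (0 : ℂ) 1) (w : ℂ) :
      (z, w) ∈ detVariety Ψ ↔ (P z).eval w = 0 := by
    rw [mem_detVariety_iff]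
    constructor
    · rintro ⟨hb, hu⟩
      exact ((hPz z hz).2.2.2 w (mem_ball_zero_iff.1 hb.2)).1 hu
    · intro h
      have hw := (hPz z hz).2.2.1 w h
      exact ⟨⟨hz, mem_ball_zero_iff.2 hw⟩, ((hPz z hz).2.2.2 w hw).2 h⟩
  have hWV (z : ℂ) (hz : z ∈ ball (0 : ℂ) 1) (i : Fin m) : (z, W z i) ∈ detVariety Ψ :=
    (hmem hz _).2 (hroot hz i)
  obtain ⟨ψ, q, hq, hψ⟩ := exists_polyEval_eq_mul hP hW
    (fun z hz i => ((hPz z hz).2.2.1 _ (hroot hz i)).le)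
    fun i => hV.tendsto_norm fun z hz => hWV z hz i
  refine ⟨ψ, Subset.antisymm (closure_minimal ?_ ?_) ?_⟩
  · rintro ⟨z, w⟩ hx
    have hb := hV.1 hx
    refine ⟨⟨ball_subset_closedBall hb.1, ball_subset_closedBall hb.2⟩, ?_⟩
    rw [hψ z hb.1, ← heval hb.1, (hmem hb.1 w).1 hx, mul_zero]
  · exact (isClosed_closedBall.prod isClosed_closedBall).inter
      (isClosed_eq (continuous_polyEval ψ) continuous_const)
  · rintro ⟨z, w⟩ ⟨hb, h0⟩
    exact mem_closure_of_polyEval_eq_zero hWV hq hψ hb.1 h0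

/-- A compact subset of the closed bidisc cut out by a polynomial is polynomially convex. -/
theorem isPolynomiallyConvex_of_eq {K : Set (ℂ × ℂ)} {ψ : MvPolynomial (Fin 2) ℂ}
    (hK : K = {x | x ∈ closedBidisc ∧ polyEval ψ x = 0}) : IsPolynomiallyConvex K := by
  refine ⟨?_, fun x hx => ?_⟩
  · rw [hK]
    exact ((isCompact_closedBall 0 1).prod (isCompact_closedBall 0 1)).inter_right
      (isClosed_eq (continuous_polyEval ψ) continuous_const)
  -- Applied to the two coordinates with `c = 1` and to `ψ` with `c = 0`.
  · have hb {p : MvPolynomial (Fin 2) ℂ} {c : ℝ} (hc : 0 ≤ c) (h : ∀ y ∈ K, ‖polyEval p y‖ ≤ c) :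
        ‖polyEval p x‖ ≤ c :=
      (hx p).trans (Real.iSup_le (fun y => h y y.2) hc)
    rw [hK] at hb ⊢
    refine ⟨⟨mem_closedBall_zero_iff.2 ?_, mem_closedBall_zero_iff.2 ?_⟩, norm_le_zero_iff.1 ?_⟩
    · simpa [polyEval] using hb (p := MvPolynomial.X 0) zero_le_one fun y hy => by
        simpa [polyEval] using hy.1.1
    · simpa [polyEval] using hb (p := MvPolynomial.X 1) zero_le_one fun y hy => by
        simpa [polyEval] using hy.1.2
    · exact hb le_rfl fun y hy => by rw [hy.2, norm_zero]

/-- Compactness provides boundedness, without which the real supremum takes the default value 0. -/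
theorem supNorm_le_supNorm_closure {V : Set (ℂ × ℂ)} (hV : IsCompact (closure V))
    {f : ℂ × ℂ → ℂ} (hf : Continuous f) : supNorm V f ≤ supNorm (closure V) f := by
  have hbdd : BddAbove (range fun x : closure V => ‖f x‖) := by
    have : CompactSpace (closure V) := isCompact_iff_compactSpace.mp hV
    exact (isCompact_range (hf.comp continuous_subtype_val).norm).bddAbove
  exact Real.iSup_le (fun x => le_ciSup hbdd ⟨x, subset_closure x.2⟩)
    (Real.iSup_nonneg fun _ => norm_nonneg _)

end DistinguishedVariety

end Bidisc

end

/-! ### The theorem: algebraicity gives convexity, which gives the spectral set. -/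

theorem mainTheorem8
    {H : Type*} [NormedAddCommGroup H] [InnerProductSpace ℂ H] [CompleteSpace H]
    {E : Type*} [NormedAddCommGroup E] [InnerProductSpace ℂ E] [FiniteDimensional ℂ E]
    (T₁ T₂ : H →L[ℂ] H) (hcomm : Commute T₁ T₂) (hT₁ : ‖T₁‖ ≤ 1) (hT₂ : ‖T₂‖ ≤ 1)
    (Ψ : ℂ → E →L[ℂ] E) (V : Set (ℂ × ℂ))
    (hV : Bidisc.IsAglerMcCarthyDistinguished T₁ T₂ Ψ V) :
    Bidisc.IsSpectralSet T₁ T₂ (closure V) ∧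
      (∃ ψ : MvPolynomial (Fin 2) ℂ,
        closure V = {x | x ∈ Bidisc.closedBidisc ∧ Bidisc.polyEval ψ x = 0}) ∧
      Bidisc.IsPolynomiallyConvex (closure V) := by
  obtain ⟨ψ, hψ⟩ : ∃ ψ : MvPolynomial (Fin 2) ℂ,
      closure V = {x | x ∈ Bidisc.closedBidisc ∧ Bidisc.polyEval ψ x = 0} := by
    have h := hV.distinguished
    rw [hV.eq_detVariety] at h ⊢
    exact Bidisc.exists_closure_detVariety_eq hV.contractive h
  have hconv := Bidisc.isPolynomiallyConvex_of_eq hψ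
  refine ⟨hconv.isSpectralSet hcomm fun p => (hV.norm_le p).trans ?_, ⟨ψ, hψ⟩, hconv⟩
  exact Bidisc.supNorm_le_supNorm_closure hconv.1 (Bidisc.continuous_polyEval p)
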